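/- **Setting.** Write $P=(T^-,T^+,N^-,N^+)$ for a four-dimensional point process on the whole time line $\mathbb R$: locally finite counting processes with jumps of size one and almost surely no simultaneous jumps, adapted to a filtration $(\mathcal F_t)_{t\in\mathbb R}$. Call $f:\mathbb R\to\mathbb R$ a kernel if it is measurable, nonnegative, integrable and zero on $(-\infty,0)$. Let $\mu\ge 0$, $M=(\mu,\mu,0,0)^{\top}$, let $\Phi$ be a $4\times4$ and $\Theta$ a $4\times 2$ matrix of kernels, and let $A=(A^-,A^+)$ be deterministic, nondecreasing and right-continuous, $A^\pm_t=dA^\pm((-\infty,t])$ with $dA^\pm$ finite measures carried by $[0,T)$ for some $T>0$ (for instance, $A^{\pm}$ counts the orders of a labeled agent). Suppose that $P$ has the conditional intensity $$\lambda_t=M+\Phi\star dP_t+\Theta\star dA_t,\qquad B\star d\nu_t=\int_{s<t}B_{t-s}\,d\nu_s ,$$ that is, $E\int H_t\,dP^i_t=E\int H_t\lambda^i_t\,dt$ for every component $i$ and every nonnegative predictable process $H$. Put $\hat f_z=\int e^{-izt}f_t\,dt$ for $\operatorname{Im} z\le 0$ (entrywise for matrices), and suppose that all eigenvalues of $\hat\Phi_0$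 have modulus $<1$. Suppose also that $E\,P^i((t-1,t])$ is bounded uniformly in $t\le 0$ and $i$ (as is the case when, before the agent acts, $P$ has stationary increments with finite mean intensity). **Proposition (Market impact profile).** (1) For $\operatorname{Im} z\le0$ the matrix $I-\hat\Phi_z$ is invertible; there is an integrable matrix function $\Psi$, zero on $(-\infty,0)$, with $\hat\Psi_z=\hat\Phi_z(I-\hat\Phi_z)^{-1}$ for $\operatorname{Im} z\le 0$. Every such $\Psi$ is nonnegative almost everywhere, and $$E(\lambda_t)=\big((\delta I+\Psi)\star(M+\Theta\star dA)\big)_t\qquad\text{for all }t\in\mathbb R$$ as an equality in $[0,\infty]$; both sides are finite for almost every $t$. (2) Suppose moreover that $$\Phi=\begin{pmatrix}\Phi^T&\Phi^F\\ \Phi^I&\Phi^N\end{pmatrix},\qquad \Theta=\begin{pmatrix}\Theta^T\\ \Phi^I\end{pmatrix},$$ where each $2\times2$ block $\Phi^{?}$ ($?=T,F,I,N$) has the form $\begin{pmatrix}\phi^{?,s}&\phi^{?,c}\\ \phi^{?,c}&\phi^{?,s}\end{pmatrix}$ and $\Theta^T$ has the same form with entries $\theta^{T,s},\theta^{T,c}$;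 put $\Delta\phi^{?}=\phi^{?,s}-\phi^{?,c}$ and $\Delta\theta^T=\theta^{T,s}-\theta^{T,c}$. Then $(1-\Delta\hat\phi^T_z)(1-\Delta\hat\phi^N_z)-\Delta\hat\phi^I_z\Delta\hat\phi^F_z\neq0$ for $\operatorname{Im}z\le0$; there is an integrable function $\Delta\xi$, zero on $(-\infty,0)$, with $$\widehat{\Delta\xi}_z=1-\frac{1-\Delta\hat\phi^T_z+\Delta\hat\theta^T_z}{(1-\Delta\hat\phi^T_z)(1-\Delta\hat\phi^N_z)-\Delta\hat\phi^I_z\Delta\hat\phi^F_z}\qquad(\operatorname{Im}z\le0);$$ and for every such $\Delta\xi$ and every $t\ge0$ the price $X_t=N^+((0,t])-N^-((0,t])$ is integrable, and the market impact profile is $$MI_t=E(X_t)=\big((\delta-\Delta\xi)\star\Delta\phi^I\star(A^+-A^-)\big)_t .$$ -/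

import Mathlib

open MeasureTheory Set

open scoped ENNReal

noncomputable section

namespace HawkesImpact

/-- Components of the point process `P = (T⁻, T⁺, N⁻, N⁺)`: `inl` is the trade process `T`,
`inr` is the price-jump process `N`; in each pair, index `0` is `-` and index `1` is `+`. -/
abbrev Component : Type := Fin 2 ⊕ Fin 2

/-- A causal, nonnegative, integrable function. -/
structure IsKernel (f : ℝ → ℝ) : Prop where
  measurable : Measurable f
  nonneg : ∀ t, 0 ≤ f t
  causal : ∀ t < 0, f t = 0
  integrable : Integrable f

/-- The transform `f̂ z = ∫ exp (-i z t) f t dt`. -/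
def laplace (f : ℝ → ℝ) (z : ℂ) : ℂ :=
  ∫ t : ℝ, Complex.exp (-(Complex.I * z * (t : ℂ))) * (f t : ℂ)

/-- Entrywise transform of a matrix-valued function. -/
def laplaceMatrix {m n : Type*} (F : ℝ → Matrix m n ℝ) (z : ℂ) : Matrix m n ℂ :=
  Matrix.of fun i j => laplace (fun t => F t i j) z

/-- `f` is an integrable causal function whose transform is `F` on the closed lower half plane
`Im z ≤ 0` (where the transform of such a function converges absolutely). -/
structure HasLaplace (f : ℝ → ℝ) (F : ℂ → ℂ) : Prop where
  integrable : Integrable f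
  causal : ∀ t < 0, f t = 0
  transform : ∀ z : ℂ, z.im ≤ 0 → laplace f z = F z

/-- `Ψ` is the integrable causal matrix function given by `Ψ̂ = Φ̂ (I - Φ̂)⁻¹`. -/
def IsResolvent (Φ Ψ : ℝ → Matrix Component Component ℝ) : Prop :=
  ∀ i j, HasLaplace (fun t => Ψ t i j)
    (fun z => (laplaceMatrix Φ z * (1 - laplaceMatrix Φ z)⁻¹) i j)

/-- The stability condition: the eigenvalues of `Φ̂₀ = ∫ Φ` have modulus `< 1`. -/
def Stable (Φ : ℝ → Matrix Component Component ℝ) : Prop :=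
  ∀ x ∈ spectrum ℂ (laplaceMatrix Φ 0), ‖x‖ < 1

/-- The doubly symmetric matrix with self term `s` and cross term `c`. -/
def selfCross (s c : ℝ) : Matrix (Fin 2) (Fin 2) ℝ := !![s, c; c, s]

/-- The baseline intensity `M = (μ, μ, 0, 0)`. -/
def baseline (μ : ℝ) : Component → ℝ≥0∞ := Sum.elim (fun _ => ENNReal.ofReal μ) (fun _ => 0)

/-- `(f ⋆ dν)_t = ∫_{s < t} f (t - s) dν(s)` for a nonnegative causal `f`. A jump of `ν` at the time
`t` itself is not counted, as usual for intensities. -/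
def convMeasure (f : ℝ → ℝ) (ν : Measure ℝ) (t : ℝ) : ℝ≥0∞ :=
  ∫⁻ s in Iio t, ENNReal.ofReal (f (t - s)) ∂ν

/-- The deterministic part `M + Θ ⋆ dA` of the intensity; `α i` is the measure `dA`, with
`i = 0, 1` for `A⁻, A⁺`. -/
def exogenous (μ : ℝ) (Θ : ℝ → Matrix Component (Fin 2) ℝ) (α : Fin 2 → Measure ℝ)
    (i : Component) (t : ℝ) : ℝ≥0∞ :=
  baseline μ i + ∑ j, convMeasure (fun u => Θ u i j) (α j) t

/-- The intensity `λ = M + Φ ⋆ dP + Θ ⋆ dA` attached to the random measures `P i ω = dPⁱ(ω)`. -/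
def intensity {Ω : Type*} (μ : ℝ) (Φ : ℝ → Matrix Component Component ℝ)
    (Θ : ℝ → Matrix Component (Fin 2) ℝ) (α : Fin 2 → Measure ℝ)
    (P : Component → Ω → Measure ℝ) (i : Component) (t : ℝ) (ω : Ω) : ℝ≥0∞ :=
  exogenous μ Θ α i t + ∑ j, convMeasure (fun u => Φ u i j) (P j ω) t

/-- A locally finite point configuration on `ℝ`, as a counting measure. -/
def IsCounting (ν : Measure ℝ) : Prop := ∀ s t : ℝ, ∃ n : ℕ, ν (Ioc s t) = n

/-- The predictable σ-algebra on `ℝ × Ω`, generated by the sets `(s, ∞) × F` with `F ∈ 𝓕 s`. -/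
@[reducible]
def predictable {Ω : Type*} {m : MeasurableSpace Ω} (𝓕 : Filtration ℝ m) :
    MeasurableSpace (ℝ × Ω) :=
  MeasurableSpace.generateFrom {S | ∃ s F, MeasurableSet[𝓕 s] F ∧ S = Ioi s ×ˢ F}

/-- `lam` is the conditional intensity of the random measure `N` with respect to `𝓕`:
`E ∫ H_t dN_t = E ∫ H_t lam_t dt` for all nonnegative predictable processes `H`. -/
def HasIntensity {Ω : Type*} {m : MeasurableSpace Ω} (ℙ : Measure Ω) (𝓕 : Filtration ℝ m)
    (N : Ω → Measure ℝ) (lam : ℝ → Ω → ℝ≥0∞) : Prop :=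
  ∀ H : ℝ × Ω → ℝ≥0∞, Measurable[predictable 𝓕] H →
    ∫⁻ ω, (∫⁻ t, H (t, ω) ∂(N ω)) ∂ℙ = ∫⁻ ω, (∫⁻ t : ℝ, H (t, ω) * lam t ω) ∂ℙ

/-- `P` is a Hawkes process (on the whole time line) with kernel `Φ`, baseline intensity
`(μ, μ, 0, 0)` and a deterministic labeled agent `A` acting through the kernel `Θ`. -/
structure IsLabeledHawkes {Ω : Type*} {m : MeasurableSpace Ω} (ℙ : Measure Ω)
    (𝓕 : Filtration ℝ m) (μ : ℝ) (Φ : ℝ → Matrix Component Component ℝ)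
    (Θ : ℝ → Matrix Component (Fin 2) ℝ) (α : Fin 2 → Measure ℝ)
    (P : Component → Ω → Measure ℝ) : Prop where
  counting : ∀ i ω, IsCounting (P i ω)
  /-- Jumps have size one, and no two components jump simultaneously. -/
  simple : ∀ᵐ ω ∂ℙ, ∀ t, ∑ i, P i ω {t} ≤ 1
  adapted : ∀ i s t, Measurable[𝓕 t] fun ω => P i ω (Ioc s t)
  hasIntensity : ∀ i, HasIntensity ℙ 𝓕 (P i) (intensity μ Φ Θ α P i)

/-- The price `X_t = N⁺_t - N⁻_t`, `t ≥ 0`, counted from time `0`. -/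
def price {Ω : Type*} (P : Component → Ω → Measure ℝ) (t : ℝ) (ω : Ω) : ℝ :=
  (P (Sum.inr 1) ω).real (Ioc 0 t) - (P (Sum.inr 0) ω).real (Ioc 0 t)

/-- `A⁺_t - A⁻_t`, where `Aⁱ_t = α i (-∞, t]`. -/
def agentImbalance (α : Fin 2 → Measure ℝ) (t : ℝ) : ℝ :=
  (α 1).real (Iic t) - (α 0).real (Iic t)

/-- Convolution of real functions on the line. -/
def conv (f g : ℝ → ℝ) : ℝ → ℝ := convolution f g (ContinuousLinearMap.mul ℝ ℝ) volume

/-- `(1 - Δφ̂ᵀ)(1 - Δφ̂ᴺ) - Δφ̂ᴵ Δφ̂ᶠ` at `z`, for given imbalances `Δφ`. -/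
def impactDenominator (dT dI dN dF : ℝ → ℝ) (z : ℂ) : ℂ :=
  (1 - laplace dT z) * (1 - laplace dN z) - laplace dI z * laplace dF z

/-- The transform that defines `Δξ`. -/
def xiTransform (dT dI dN dF dθ : ℝ → ℝ) (z : ℂ) : ℂ :=
  1 - (1 - laplace dT z + laplace dθ z) / impactDenominator dT dI dN dF z

end HawkesImpact

end

/-! The argument is a renewal equation for the mean intensity, solved in a class of functions where
the solution is unique. Three difficulties shape it: the mean intensity is not known in advance to
be finite, the baseline is not integrable on the whole line, and the equation must hold at every
time rather than almost every time.

The algebraic core is subinvariance. If `G = ∫ Φ` has spectral radius less than one, then `∑ G ^ n`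
converges and is nonnegative, so a finite vector with `x ≤ c + G x` obeys a bound depending only on
`c`, and `x ≤ G x` forces `x ≤ 0`. Applied to the moduli of a null vector of `1 - Φ̂_z`, whose
entries satisfy `|Φ̂_z| ≤ G`, this gives invertibility on the closed half plane. Applied to sizes of
functions it gives a priori bounds and uniqueness. The size used is `windowSup`, the largest mass of
a unit interval: it is finite for constants, and convolution with a kernel multiplies it by at most
the mass of the kernel. Hence `u = v + K ⋆ u` has only one solution with bounded windows, namely `v
+ R ⋆ v` with `R = ∑ K^⋆n` (`eq_renewal_solution`). The transform of `R` is `Φ̂ (1 - Φ̂)⁻¹`, and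
injectivity of the transform identifies every `Ψ` with `R` almost everywhere.

To see that the mean measures have bounded windows, the process is stopped after `n` points past
time `0`. The stopped mean has finite windows because of the bound on the past, and it satisfies the
renewal inequality because the kernels are causal; subinvariance bounds it uniformly in `n`, and `n
→ ∞` concludes (`windowSup_meanOn_univ_ne_top`). The defining property of the intensity then turns
the mean measure into the renewal solution (`mean_intensity_renewal`).

For the impact, linearity splits the mean intensity into a baseline part, equal for up and down
jumps because exchanging `-` and `+` preserves the equation and its solution is unique, and an
integrable response to the agent. Differences of rows reduce the transformed `4 × 4` system for the
response to a `2 × 2` system, whose solution by elimination is `(1 - ξ̂) ΔÎ (Â⁺ - Â⁻)`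
(`laplace_responseImbalance`). Inverting the transform and integrating in time, with Fubini moving
the primitive from the density to `dA`, gives the formula. -/

namespace HawkesImpact

/-! ### Nonnegative matrices with spectral radius less than one. -/

section SubinvariantVectors

open Filter Topology

attribute [local instance] Matrix.linftyOpNormedRing Matrix.linftyOpNormedAlgebra

variable {ι : Type*} [Fintype ι] [DecidableEq ι]

/-- The powers of a complex matrix with spectral radius less than one are summable. -/
theorem summable_pow_of_spectrum (A : Matrix ι ι ℂ) (hA : ∀ x ∈ spectrum ℂ A, ‖x‖ < 1) :
    Summable fun n : ℕ => A ^ n := by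
  rcases isEmpty_or_nonempty ι with h | h
  · simp only [Subsingleton.elim _ (0 : Matrix ι ι ℂ), summable_zero]
  have hlt : spectralRadius ℂ A < (1 : NNReal) :=
    spectrum.spectralRadius_lt_of_forall_lt A fun z hz => by simpa using! hA z hz
  obtain ⟨r, hr, hr1⟩ := ENNReal.lt_iff_exists_nnreal_btwn.1 hlt
  -- Gelfand's formula: `‖A ^ n‖ ^ (1 / n)` tends to the spectral radius, hence is eventually below
  -- `r < 1`.
  have hev : ∀ᶠ n : ℕ in atTop, ‖A ^ n‖ ≤ (r : ℝ) ^ n := by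
    filter_upwards [(spectrum.pow_nnnorm_pow_one_div_tendsto_nhds_spectralRadius A).eventually
      (gt_mem_nhds hr), eventually_gt_atTop 0] with n hn hn0
    have h1 : ((‖A ^ n‖₊ : ℝ≥0∞) ^ (1 / n : ℝ)) ^ (n : ℝ) ≤ (r : ℝ≥0∞) ^ (n : ℝ) :=
      ENNReal.rpow_le_rpow hn.le (by positivity)
    rw [← ENNReal.rpow_mul, one_div, inv_mul_cancel₀ (by positivity), ENNReal.rpow_one,
      ENNReal.rpow_natCast] at h1
    have h2 : ‖A ^ n‖₊ ≤ r ^ n := by exact_mod_cast h1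
    exact_mod_cast h2
  exact Summable.of_norm_bounded_eventually_nat
    (summable_geometric_of_lt_one r.coe_nonneg (by exact_mod_cast hr1)) hev

variable {G : Matrix ι ι ℝ}

theorem summable_pow_apply (hG : ∀ x ∈ spectrum ℂ (G.map Complex.ofReal), ‖x‖ < 1) (i j : ι) :
    Summable fun n : ℕ => (G ^ n) i j := by
  have h := summable_pow_of_spectrum _ hG
  have h2 : Summable fun n : ℕ => ((G.map Complex.ofReal) ^ n) i j :=
    Pi.summable.1 (Pi.summable.1 h i) j
  have h3 : ∀ n : ℕ, ((G.map Complex.ofReal) ^ n) i j = (((G ^ n) i j : ℝ) : ℂ) := fun n => by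
    have := congrFun (congrFun (Matrix.map_pow G Complex.ofRealHom n) i) j
    exact this.symm
  simp_rw [h3] at h2
  exact Complex.summable_ofReal.1 h2

theorem pow_apply_nonneg (h0 : ∀ i j, 0 ≤ G i j) (n : ℕ) : ∀ i j, 0 ≤ (G ^ n) i j := by
  induction n with
  | zero => intro i j; rw [pow_zero, Matrix.one_apply]; split_ifs <;> simp
  | succ n ih =>
    intro i j
    rw [pow_succ, Matrix.mul_apply]
    exact Finset.sum_nonneg fun k _ => mul_nonneg (ih i k) (h0 k j)

/-- The resolvent of a nonnegative matrix with spectral radius less than one is nonnegative, so it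
turns an inequality `x ≤ c + G x` into a bound. -/
theorem exists_bound_of_le_add_mulVec (h0 : ∀ i j, 0 ≤ G i j)
    (hG : ∀ x ∈ spectrum ℂ (G.map Complex.ofReal), ‖x‖ < 1) :
    ∃ S : Matrix ι ι ℝ, ∀ c x : ι → ℝ, (∀ i, x i ≤ c i + ∑ j, G i j * x j) →
      ∀ i, x i ≤ ∑ j, S i j * c j := by
  have hs : Summable fun n : ℕ => G ^ n :=
    Pi.summable.2 fun i => Pi.summable.2 fun j => summable_pow_apply hG i j
  have hS := hs.tsum_pow_mul_one_sub
  have hS0 : ∀ i j, 0 ≤ (∑' n : ℕ, G ^ n) i j := fun i j => by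
    rw [← (Pi.hasSum.1 (Pi.hasSum.1 hs.hasSum i) j).tsum_eq]
    exact tsum_nonneg fun n => pow_apply_nonneg h0 n i j
  refine ⟨∑' n : ℕ, G ^ n, fun c x hx i => ?_⟩
  have hxe : x = (∑' n : ℕ, G ^ n).mulVec ((1 - G).mulVec x) := by
    rw [Matrix.mulVec_mulVec, hS, Matrix.one_mulVec]
  rw [hxe]
  refine Finset.sum_le_sum fun j _ => mul_le_mul_of_nonneg_left ?_ (hS0 i j)
  rw [Matrix.sub_mulVec, Matrix.one_mulVec]
  have := hx j
  simp only [Pi.sub_apply, Matrix.mulVec, dotProduct]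
  linarith

theorem nonpos_of_le_mulVec (h0 : ∀ i j, 0 ≤ G i j)
    (hG : ∀ x ∈ spectrum ℂ (G.map Complex.ofReal), ‖x‖ < 1) {x : ι → ℝ}
    (hx : ∀ i, x i ≤ ∑ j, G i j * x j) (i : ι) : x i ≤ 0 := by
  obtain ⟨S, hS⟩ := exists_bound_of_le_add_mulVec h0 hG
  simpa using hS 0 x (by simpa using hx) i

/-- A null vector satisfies `v = Z v`, so its moduli satisfy `|v| ≤ G |v|` and vanish by
subinvariance. -/
theorem isUnit_det_one_sub_of_norm_le (h0 : ∀ i j, 0 ≤ G i j)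
    (hG : ∀ x ∈ spectrum ℂ (G.map Complex.ofReal), ‖x‖ < 1) {Z : Matrix ι ι ℂ}
    (hZ : ∀ i j, ‖Z i j‖ ≤ G i j) : IsUnit (1 - Z).det := by
  rw [isUnit_iff_ne_zero]
  intro hdet
  obtain ⟨v, hv, hv0⟩ := Matrix.exists_mulVec_eq_zero_iff.2 hdet
  rw [Matrix.sub_mulVec, Matrix.one_mulVec, sub_eq_zero] at hv0
  refine hv (funext fun i => norm_le_zero_iff.1 (nonpos_of_le_mulVec h0 hG (x := fun i => ‖v i‖)
    (fun i => ?_) i))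
  calc ‖v i‖ = ‖∑ j, Z i j * v j‖ := congrArg norm (congrFun hv0 i)
    _ ≤ ∑ j, ‖Z i j * v j‖ := norm_sum_le _ _
    _ ≤ ∑ j, G i j * ‖v j‖ := Finset.sum_le_sum fun j _ => by
        rw [norm_mul]; exact mul_le_mul_of_nonneg_right (hZ i j) (norm_nonneg _)

end SubinvariantVectors

/-! ### Convolution in `[0, ∞]` and the mass of unit windows. -/

section NonnegativeConvolution

variable {F H : ℝ → ℝ≥0∞} {ν : Measure ℝ}

/-- The convolution `∫ F (t - s) dν(s)` of a nonnegative function with a measure. -/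
noncomputable def mconv (F : ℝ → ℝ≥0∞) (ν : Measure ℝ) (t : ℝ) : ℝ≥0∞ := ∫⁻ s, F (t - s) ∂ν

/-- The largest mass that `ν` gives to an interval of length one. -/
noncomputable def windowSup (ν : Measure ℝ) : ℝ≥0∞ := ⨆ a : ℝ, ν (Ioc (a - 1) a)

theorem measure_window_le (ν : Measure ℝ) (a : ℝ) : ν (Ioc (a - 1) a) ≤ windowSup ν :=
  le_iSup (fun a : ℝ => ν (Ioc (a - 1) a)) a

theorem windowSup_le_univ (ν : Measure ℝ) : windowSup ν ≤ ν univ :=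
  iSup_le fun _ => measure_mono (subset_univ _)

theorem windowSup_mono {ν ν' : Measure ℝ} (h : ν ≤ ν') : windowSup ν ≤ windowSup ν' :=
  iSup_mono fun _ => h _

theorem windowSup_add_le (ν ν' : Measure ℝ) :
    windowSup (ν + ν') ≤ windowSup ν + windowSup ν' :=
  iSup_le fun a => add_le_add (measure_window_le ν a) (measure_window_le ν' a)

theorem windowSup_zero : windowSup 0 = 0 := by simp [windowSup]

theorem windowSup_sum_le {κ : Type*} (s : Finset κ) (ν : κ → Measure ℝ) :
    windowSup (∑ j ∈ s, ν j) ≤ ∑ j ∈ s, windowSup (ν j) := by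
  classical
  induction s using Finset.induction_on with
  | empty => simp [windowSup_zero]
  | insert a s ha ih =>
    rw [Finset.sum_insert ha, Finset.sum_insert ha]
    exact (windowSup_add_le _ _).trans (add_le_add le_rfl ih)

theorem iUnion_window : ⋃ k : ℤ, Ioc ((k : ℝ) - 1) k = univ := by
  refine eq_univ_of_forall fun x => mem_iUnion.2 ⟨⌈x⌉, ?_, Int.le_ceil x⟩
  linarith [Int.ceil_lt_add_one x]

theorem eq_zero_of_windowSup_eq_zero (h : windowSup ν = 0) : ν = 0 := by
  rw [← Measure.measure_univ_eq_zero, ← iUnion_window]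
  exact measure_iUnion_null fun k => le_zero_iff.1 (h ▸ measure_window_le ν k)

theorem measure_Ioc_lt_top (h : windowSup ν ≠ ∞) (a b : ℝ) : ν (Ioc a b) < ∞ := by
  have hsub : Ioc a b ⊆ ⋃ k ∈ Finset.Icc ⌈a⌉ ⌈b⌉, Ioc ((k : ℝ) - 1) k := fun x hx =>
    mem_iUnion₂.2 ⟨⌈x⌉, Finset.mem_Icc.2 ⟨Int.ceil_mono hx.1.le, Int.ceil_mono hx.2⟩,
      by linarith [Int.ceil_lt_add_one x], Int.le_ceil x⟩
  refine (measure_mono hsub).trans_lt ((measure_biUnion_finset_le _ _).trans_lt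
    (ENNReal.sum_lt_top.2 fun k _ => (measure_window_le ν k).trans_lt h.lt_top))

theorem measurable_mconv [SFinite ν] (hF : Measurable F) : Measurable (mconv F ν) := by
  unfold mconv
  exact Measurable.lintegral_prod_right' (f := fun p : ℝ × ℝ => F (p.1 - p.2)) (by fun_prop)

theorem lintegral_mul_mconv [SFinite ν] (hF : Measurable F) (hH : Measurable H) :
    ∫⁻ t, H t * mconv F ν t = ∫⁻ s, (∫⁻ t, H t * F (t - s)) ∂ν := by
  unfold mconv
  rw [lintegral_lintegral_swap (f := fun s t => H t * F (t - s)) (by fun_prop)]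
  refine lintegral_congr fun t => ?_
  rw [lintegral_const_mul _ (by fun_prop)]

theorem lintegral_mconv [SFinite ν] (hF : Measurable F) :
    ∫⁻ t, mconv F ν t = (∫⁻ t, F t) * ν univ := by
  have h := lintegral_mul_mconv (ν := ν) hF (H := fun _ => 1) measurable_const
  simp only [one_mul] at h
  rw [h]
  simp_rw [lintegral_sub_right_eq_self F]
  rw [lintegral_const]

/-- By Tonelli the left side averages, with weight `F v`, the mass that `ν` gives to the window
translated by `-v`. A translated unit window is again a unit window. -/
theorem setLIntegral_window_mconv_le [SFinite ν] (hF : Measurable F) (a : ℝ) :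
    ∫⁻ t in Ioc (a - 1) a, mconv F ν t ≤ (∫⁻ t, F t) * windowSup ν := by
  have hI : Measurable ((Ioc (a - 1) a).indicator (1 : ℝ → ℝ≥0∞)) :=
    measurable_one.indicator measurableSet_Ioc
  have e1 : ∫⁻ t in Ioc (a - 1) a, mconv F ν t
      = ∫⁻ t, (Ioc (a - 1) a).indicator 1 t * mconv F ν t := by
    rw [← lintegral_indicator measurableSet_Ioc]
    refine lintegral_congr fun t => ?_
    by_cases ht : t ∈ Ioc (a - 1) a <;> simp [ht]
  have e2 : ∀ s, ∫⁻ t, (Ioc (a - 1) a).indicator (1 : ℝ → ℝ≥0∞) t * F (t - s)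
      = ∫⁻ v, (Ioc (a - 1) a).indicator (1 : ℝ → ℝ≥0∞) (v + s) * F v := fun s => by
    rw [← lintegral_sub_right_eq_self
      (fun v => (Ioc (a - 1) a).indicator (1 : ℝ → ℝ≥0∞) (v + s) * F v) s]
    simp
  rw [e1, lintegral_mul_mconv hF hI]
  simp_rw [e2]
  rw [lintegral_lintegral_swap (by fun_prop), ← lintegral_mul_const _ hF]
  refine lintegral_mono fun v => ?_
  rw [lintegral_mul_const _ (by fun_prop), mul_comm]
  gcongr
  have e3 : (fun s => (Ioc (a - 1) a).indicator (1 : ℝ → ℝ≥0∞) (v + s))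
      = (Ioc ((a - v) - 1) (a - v)).indicator 1 := by
    funext s
    by_cases hs : s ∈ Ioc ((a - v) - 1) (a - v)
    · rw [indicator_of_mem hs, indicator_of_mem]
      · rfl
      · exact ⟨by linarith [hs.1], by linarith [hs.2]⟩
    · rw [indicator_of_notMem hs, indicator_of_notMem]
      exact fun h => hs ⟨by linarith [h.1], by linarith [h.2]⟩
  rw [e3, lintegral_indicator_one measurableSet_Ioc]
  exact measure_window_le ν _

theorem windowSup_withDensity_mconv_le [SFinite ν] (hF : Measurable F) :
    windowSup (volume.withDensity (mconv F ν)) ≤ (∫⁻ t, F t) * windowSup ν :=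
  iSup_le fun a => by
    rw [withDensity_apply _ measurableSet_Ioc]
    exact setLIntegral_window_mconv_le hF a

theorem mconv_withDensity (hF : Measurable F) {u : ℝ → ℝ≥0∞} (hu : Measurable u) :
    mconv F (volume.withDensity u) = lconvolution F u volume := by
  rw [lconvolution_comm]
  funext t
  rw [mconv, lintegral_withDensity_eq_lintegral_mul _ hu (by fun_prop), lconvolution_def]
  simp [sub_eq_neg_add]

theorem lconvolution_add_right {f g h : ℝ → ℝ≥0∞} (hf : Measurable f) (hg : Measurable g) :
    lconvolution f (fun t => g t + h t) volume =
      fun t => lconvolution f g volume t + lconvolution f h volume t := by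
  funext t
  simp only [lconvolution_def, mul_add]
  exact lintegral_add_left (by fun_prop) _

theorem lconvolution_add_left {f g h : ℝ → ℝ≥0∞} (hf : Measurable f) (hh : Measurable h) :
    lconvolution (fun t => f t + g t) h volume =
      fun t => lconvolution f h volume t + lconvolution g h volume t := by
  funext t
  simp only [lconvolution_def, add_mul]
  exact lintegral_add_left (by fun_prop) _

theorem lconvolution_sum_right {κ : Type*} {s : Finset κ} {f : ℝ → ℝ≥0∞} {g : κ → ℝ → ℝ≥0∞}
    (hf : Measurable f) (hg : ∀ j, Measurable (g j)) :
    lconvolution f (fun t => ∑ j ∈ s, g j t) volume =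
      fun t => ∑ j ∈ s, lconvolution f (g j) volume t := by
  funext t
  simp only [lconvolution_def, Finset.mul_sum]
  exact lintegral_finsetSum _ fun j _ => by have := hg j; fun_prop

theorem lconvolution_sum_left {κ : Type*} {s : Finset κ} {f : κ → ℝ → ℝ≥0∞} {g : ℝ → ℝ≥0∞}
    (hf : ∀ j, Measurable (f j)) (hg : Measurable g) :
    lconvolution (fun t => ∑ j ∈ s, f j t) g volume =
      fun t => ∑ j ∈ s, lconvolution (f j) g volume t := by
  funext t
  simp only [lconvolution_def, Finset.sum_mul]
  exact lintegral_finsetSum _ fun j _ => by have := hf j; fun_prop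

theorem lconvolution_tsum_right {f : ℝ → ℝ≥0∞} {g : ℕ → ℝ → ℝ≥0∞}
    (hf : Measurable f) (hg : ∀ n, Measurable (g n)) :
    lconvolution f (fun t => ∑' n, g n t) volume =
      fun t => ∑' n, lconvolution f (g n) volume t := by
  funext t
  simp only [lconvolution_def, ← ENNReal.tsum_mul_left]
  exact lintegral_tsum fun n => by have := hg n; fun_prop

theorem lconvolution_congr_right {f g h : ℝ → ℝ≥0∞} (hgh : g =ᵐ[volume] h) :
    lconvolution f g volume = lconvolution f h volume := by
  funext t
  rw [lconvolution_comm, lconvolution_comm (f := f)]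
  refine lintegral_congr_ae ?_
  filter_upwards [hgh] with y hy
  rw [hy]

theorem lconvolution_congr_left {f g h : ℝ → ℝ≥0∞} (hfg : f =ᵐ[volume] g) :
    lconvolution f h volume = lconvolution g h volume := by
  rw [lconvolution_comm, lconvolution_congr_right hfg, lconvolution_comm]

theorem lintegral_lconvolution {f g : ℝ → ℝ≥0∞} (hf : Measurable f) (hg : Measurable g) :
    ∫⁻ t, lconvolution f g volume t = (∫⁻ t, f t) * ∫⁻ t, g t := by
  rw [← mconv_withDensity hf hg, lintegral_mconv hf, withDensity_apply _ MeasurableSet.univ,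
    Measure.restrict_univ]

theorem lconvolution_eq_zero_of_nonpos {f g : ℝ → ℝ≥0∞} (hf : ∀ t ≤ 0, f t = 0)
    (hg : ∀ t ≤ 0, g t = 0) {t : ℝ} (ht : t ≤ 0) : lconvolution f g volume t = 0 := by
  rw [lconvolution_def, lintegral_eq_zero_of_ae_eq_zero]
  refine Filter.Eventually.of_forall fun y => ?_
  rcases le_or_gt y 0 with hy | hy
  · simp [hf y hy]
  · simp [hg (-y + t) (by linarith)]

/-- This makes the truncated difference of two solutions of the renewal equation a subsolution of
the homogeneous one. Finiteness of `f` is what lets multiplication distribute over truncated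
subtraction. -/
theorem lconvolution_tsub_le {f g h : ℝ → ℝ≥0∞} (hf : Measurable f) (hh : Measurable h) (t : ℝ)
    (hfin : ∀ᵐ t, f t ≠ ∞) :
    lconvolution f g volume t - lconvolution f h volume t ≤
      lconvolution f (fun s => g s - h s) volume t := by
  simp only [lconvolution_def]
  refine (lintegral_sub_le _ _ (by fun_prop)).trans (lintegral_mono_ae ?_)
  filter_upwards [hfin] with y hy
  exact (ENNReal.mul_sub fun _ _ => hy).ge

end NonnegativeConvolution

/-! ### The renewal equation: resolvent kernel, uniqueness and solution. -/

section Renewal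

set_option linter.unusedSectionVars false

variable {ι : Type*} [Fintype ι] [DecidableEq ι] {G : Matrix ι ι ℝ}

/-- The bound `b` is chosen before `x`, so it is uniform over a family of subsolutions; this is what
survives the limit of the localization. Finiteness of `x` cannot be dropped, since infinite entries
may satisfy the inequality trivially. -/
theorem exists_ennreal_bound (h0 : ∀ i j, 0 ≤ G i j)
    (hG : ∀ x ∈ spectrum ℂ (G.map Complex.ofReal), ‖x‖ < 1) {c : ι → ℝ≥0∞} (hc : ∀ i, c i ≠ ∞) :
    ∃ b : ι → ℝ≥0∞, (∀ i, b i ≠ ∞) ∧ ∀ x : ι → ℝ≥0∞, (∀ i, x i ≠ ∞) →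
      (∀ i, x i ≤ c i + ∑ j, ENNReal.ofReal (G i j) * x j) → ∀ i, x i ≤ b i := by
  obtain ⟨S, hS⟩ := exists_bound_of_le_add_mulVec h0 hG
  refine ⟨fun i => ENNReal.ofReal (∑ j, S i j * (c j).toReal), fun i => ENNReal.ofReal_ne_top,
    fun x hx hle i => ?_⟩
  have hb := hS (fun j => (c j).toReal) (fun j => (x j).toReal) (fun i => ?_) i
  · exact (ENNReal.le_ofReal_iff_toReal_le (hx i) (ENNReal.toReal_nonneg.trans hb)).2 hb
  · have hfin : ∀ j ∈ Finset.univ, ENNReal.ofReal (G i j) * x j ≠ ∞ := fun j _ =>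
      ENNReal.mul_ne_top ENNReal.ofReal_ne_top (hx j)
    have := ENNReal.toReal_mono (ENNReal.add_ne_top.2 ⟨hc i, ENNReal.sum_ne_top.2 hfin⟩) (hle i)
    rw [ENNReal.toReal_add (hc i) (ENNReal.sum_ne_top.2 hfin), ENNReal.toReal_sum hfin] at this
    simpa [ENNReal.toReal_mul, ENNReal.toReal_ofReal (h0 _ _)] using this

theorem eq_zero_of_le_sum_mul (h0 : ∀ i j, 0 ≤ G i j)
    (hG : ∀ x ∈ spectrum ℂ (G.map Complex.ofReal), ‖x‖ < 1) {x : ι → ℝ≥0∞} (hx : ∀ i, x i ≠ ∞)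
    (hle : ∀ i, x i ≤ ∑ j, ENNReal.ofReal (G i j) * x j) (i : ι) : x i = 0 := by
  have h := nonpos_of_le_mulVec h0 hG (x := fun j => (x j).toReal) (fun i => ?_) i
  · exact ((ENNReal.toReal_eq_zero_iff _).1 (le_antisymm h ENNReal.toReal_nonneg)).resolve_right
      (hx i)
  · have hfin : ∀ j ∈ Finset.univ, ENNReal.ofReal (G i j) * x j ≠ ∞ := fun j _ =>
      ENNReal.mul_ne_top ENNReal.ofReal_ne_top (hx j)
    have := ENNReal.toReal_mono (ENNReal.sum_ne_top.2 hfin) (hle i)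
    rw [ENNReal.toReal_sum hfin] at this
    simpa [ENNReal.toReal_mul, ENNReal.toReal_ofReal (h0 _ _)] using this

/-- The convolution powers `K, K ⋆ K, …` of a matrix of nonnegative functions. -/
noncomputable def convPow (K : ι → ι → ℝ → ℝ≥0∞) : ℕ → ι → ι → ℝ → ℝ≥0∞
  | 0 => K
  | n + 1 => fun i j t => ∑ l, lconvolution (K i l) (convPow K n l j) volume t

/-- The renewal kernel `K + K ⋆ K + …`. -/
noncomputable def renewal (K : ι → ι → ℝ → ℝ≥0∞) (i j : ι) (t : ℝ) : ℝ≥0∞ :=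
  ∑' n, convPow K n i j t

variable {K : ι → ι → ℝ → ℝ≥0∞}

theorem measurable_convPow (hK : ∀ i j, Measurable (K i j)) (n : ℕ) :
    ∀ i j, Measurable (convPow K n i j) := by
  induction n with
  | zero => exact hK
  | succ n ih =>
    intro i j
    exact Finset.measurable_sum _ fun l _ => measurable_lconvolution _ (hK i l) (ih l j)

theorem measurable_renewal (hK : ∀ i j, Measurable (K i j)) (i j : ι) :
    Measurable (renewal K i j) :=
  Measurable.tsum fun n => measurable_convPow hK n i j

theorem convPow_of_nonpos (h : ∀ i j, ∀ t ≤ 0, K i j t = 0) (n : ℕ) :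
    ∀ i j, ∀ t ≤ 0, convPow K n i j t = 0 := by
  induction n with
  | zero => exact h
  | succ n ih =>
    intro i j t ht
    exact Finset.sum_eq_zero fun l _ => lconvolution_eq_zero_of_nonpos (h i l) (ih l j) ht

theorem renewal_of_nonpos (h : ∀ i j, ∀ t ≤ 0, K i j t = 0) (i j : ι) {t : ℝ} (ht : t ≤ 0) :
    renewal K i j t = 0 :=
  ENNReal.tsum_eq_zero.2 fun n => convPow_of_nonpos h n i j t ht

theorem renewal_eq (hK : ∀ i j, Measurable (K i j)) (i j : ι) (t : ℝ) :
    renewal K i j t = K i j t + ∑ l, lconvolution (K i l) (renewal K l j) volume t := by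
  unfold renewal
  rw [tsum_eq_zero_add' ENNReal.summable]
  refine congrArg₂ _ rfl ?_
  simp_rw [lconvolution_tsum_right (hK i _) fun n => measurable_convPow hK n _ j]
  exact Summable.tsum_finsetSum fun l _ => ENNReal.summable

theorem lintegral_convPow (hK : ∀ i j, Measurable (K i j)) (h0 : ∀ i j, 0 ≤ G i j)
    (hKG : ∀ i j, ∫⁻ t, K i j t = ENNReal.ofReal (G i j)) (n : ℕ) :
    ∀ i j, ∫⁻ t, convPow K n i j t = ENNReal.ofReal ((G ^ (n + 1)) i j) := by
  induction n with
  | zero => simpa [convPow] using hKG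
  | succ n ih =>
    intro i j
    rw [pow_succ', Matrix.mul_apply,
      ENNReal.ofReal_sum_of_nonneg fun l _ => mul_nonneg (h0 i l) (pow_apply_nonneg h0 _ l j)]
    simp only [convPow]
    rw [lintegral_finsetSum _ fun l _ =>
      measurable_lconvolution _ (hK i l) (measurable_convPow hK n l j)]
    refine Finset.sum_congr rfl fun l _ => ?_
    rw [lintegral_lconvolution (hK i l) (measurable_convPow hK n l j), hKG, ih,
      ENNReal.ofReal_mul (h0 i l)]

/-- Masses multiply under convolution, so the mass of the series is `∑ G ^ (n + 1)`, which
converges. -/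
theorem lintegral_renewal_ne_top (hK : ∀ i j, Measurable (K i j)) (h0 : ∀ i j, 0 ≤ G i j)
    (hG : ∀ x ∈ spectrum ℂ (G.map Complex.ofReal), ‖x‖ < 1)
    (hKG : ∀ i j, ∫⁻ t, K i j t = ENNReal.ofReal (G i j)) (i j : ι) :
    ∫⁻ t, renewal K i j t ≠ ∞ := by
  unfold renewal
  rw [lintegral_tsum fun n => (measurable_convPow hK n i j).aemeasurable]
  simp_rw [lintegral_convPow hK h0 hKG]
  rw [← ENNReal.ofReal_tsum_of_nonneg (fun n => pow_apply_nonneg h0 _ i j)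
    ((summable_nat_add_iff 1).2 (summable_pow_apply hG i j))]
  exact ENNReal.ofReal_ne_top

theorem windowSup_lconvolution_le {f u : ℝ → ℝ≥0∞} (hf : Measurable f) (hu : Measurable u) :
    windowSup (volume.withDensity (lconvolution f u volume)) ≤
      (∫⁻ t, f t) * windowSup (volume.withDensity u) := by
  rw [← mconv_withDensity hf hu]
  exact windowSup_withDensity_mconv_le hf

theorem withDensity_sum_fun {s : Finset ι} {f : ι → ℝ → ℝ≥0∞} (hf : ∀ j, Measurable (f j)) :
    (volume : Measure ℝ).withDensity (fun t => ∑ j ∈ s, f j t) =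
      ∑ j ∈ s, volume.withDensity (f j) := by
  induction s using Finset.induction_on with
  | empty => simp
  | insert a s ha ih =>
    simp_rw [Finset.sum_insert ha]
    rw [← ih, ← withDensity_add_left (hf a)]
    rfl

theorem windowSup_matrix_lconvolution_le {u : ι → ℝ → ℝ≥0∞} (hK : ∀ i j, Measurable (K i j))
    (hu : ∀ j, Measurable (u j)) (i : ι) :
    windowSup (volume.withDensity fun t => ∑ j, lconvolution (K i j) (u j) volume t) ≤
      ∑ j, (∫⁻ t, K i j t) * windowSup (volume.withDensity (u j)) := by
  rw [withDensity_sum_fun fun j => measurable_lconvolution _ (hK i j) (hu j)]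
  exact (windowSup_sum_le _ _).trans
    (Finset.sum_le_sum fun j _ => windowSup_lconvolution_le (hK i j) (hu j))

theorem ae_ne_top_of_windowSup {u : ℝ → ℝ≥0∞} (hu : Measurable u)
    (h : windowSup (volume.withDensity u) ≠ ∞) : ∀ᵐ t, u t < ∞ := by
  have h1 : ∀ k : ℤ, ∀ᵐ t ∂volume.restrict (Ioc ((k : ℝ) - 1) k), u t < ∞ := fun k => by
    refine ae_lt_top hu ?_
    rw [← withDensity_apply _ measurableSet_Ioc]
    exact ((measure_window_le _ _).trans_lt h.lt_top).ne
  have h2 := (ae_restrict_iUnion_iff (fun k : ℤ => Ioc ((k : ℝ) - 1) (k : ℝ))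
    (fun t => u t < ∞)).2 h1
  rwa [iUnion_window, Measure.restrict_univ] at h2

/-- A solution of `p ≤ K ⋆ p` with bounded windows vanishes. -/
theorem ae_eq_zero_of_le_lconvolution (hK : ∀ i j, Measurable (K i j)) (h0 : ∀ i j, 0 ≤ G i j)
    (hG : ∀ x ∈ spectrum ℂ (G.map Complex.ofReal), ‖x‖ < 1)
    (hKG : ∀ i j, ∫⁻ t, K i j t = ENNReal.ofReal (G i j)) {p : ι → ℝ → ℝ≥0∞}
    (hp : ∀ i, Measurable (p i)) (hfin : ∀ i, windowSup (volume.withDensity (p i)) ≠ ∞)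
    (hle : ∀ i t, p i t ≤ ∑ j, lconvolution (K i j) (p j) volume t) (i : ι) :
    p i =ᵐ[volume] 0 := by
  rw [← withDensity_eq_zero_iff (hp i).aemeasurable]
  refine eq_zero_of_windowSup_eq_zero (eq_zero_of_le_sum_mul h0 hG hfin (fun i => ?_) i)
  simp_rw [← hKG]
  exact (windowSup_mono (withDensity_mono (Filter.Eventually.of_forall (hle i)))).trans
    (windowSup_matrix_lconvolution_le hK hp i)

/-- The renewal equation `u = v + K ⋆ u` has only one solution with bounded windows. -/
theorem eq_of_renewal_equation (hK : ∀ i j, Measurable (K i j)) (h0 : ∀ i j, 0 ≤ G i j)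
    (hG : ∀ x ∈ spectrum ℂ (G.map Complex.ofReal), ‖x‖ < 1)
    (hKG : ∀ i j, ∫⁻ t, K i j t = ENNReal.ofReal (G i j)) {v u u' : ι → ℝ → ℝ≥0∞}
    (hu : ∀ i, Measurable (u i)) (hu' : ∀ i, Measurable (u' i))
    (hfin : ∀ i, windowSup (volume.withDensity (u i)) ≠ ∞)
    (hfin' : ∀ i, windowSup (volume.withDensity (u' i)) ≠ ∞)
    (heq : ∀ i t, u i t = v i t + ∑ j, lconvolution (K i j) (u j) volume t)
    (heq' : ∀ i t, u' i t = v i t + ∑ j, lconvolution (K i j) (u' j) volume t) :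
    u = u' := by
  have hKfin : ∀ i j, ∀ᵐ t, K i j t ≠ ∞ := fun i j => by
    refine (ae_lt_top (hK i j) ?_).mono fun t ht => ht.ne
    rw [hKG]; exact ENNReal.ofReal_ne_top
  have key : ∀ w w' : ι → ℝ → ℝ≥0∞, (∀ i, Measurable (w i)) → (∀ i, Measurable (w' i)) →
      (∀ i, windowSup (volume.withDensity (w i)) ≠ ∞) →
      (∀ i t, w i t = v i t + ∑ j, lconvolution (K i j) (w j) volume t) →
      (∀ i t, w' i t = v i t + ∑ j, lconvolution (K i j) (w' j) volume t) →
      ∀ i, ∀ᵐ t, w i t ≤ w' i t := fun w w' hw hw' hwf he he' i => by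
    have hz := ae_eq_zero_of_le_lconvolution hK h0 hG hKG (p := fun i t => w i t - w' i t)
      (fun i => (hw i).sub (hw' i))
      (fun i => ne_top_of_le_ne_top (hwf i) (windowSup_mono
        (withDensity_mono (Filter.Eventually.of_forall fun t => tsub_le_self))))
      (fun i t => ?_) i
    · filter_upwards [hz] with t ht
      exact tsub_eq_zero_iff_le.1 ht
    -- Moving `w'` to the right lets the common forcing `v` cancel by monotonicity, with no need for
    -- it to be finite.
    · rw [tsub_le_iff_right, he, he', add_left_comm, ← Finset.sum_add_distrib]
      gcongr with j
      exact tsub_le_iff_right.1 (lconvolution_tsub_le (hK i j) (hw' j) t (hKfin i j))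
  have hae : ∀ i, u i =ᵐ[volume] u' i := fun i => by
    filter_upwards [key u u' hu hu' hfin heq heq' i, key u' u hu' hu hfin' heq' heq i] with t h1 h2
    exact le_antisymm h1 h2
  -- Convolutions depend only on almost everywhere classes, so inserting the almost everywhere
  -- equality into the equation itself upgrades it to every `t`.
  funext i t
  rw [heq, heq']
  refine congrArg _ (Finset.sum_congr rfl fun j _ => ?_)
  rw [lconvolution_congr_right (hae j)]

/-- Insert `R = K + K ⋆ R` and use associativity. Everything stays in `[0, ∞]`, so the identity
holds at every `t` without integrability. -/
theorem renewal_solution (hK : ∀ i j, Measurable (K i j)) {v : ι → ℝ → ℝ≥0∞}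
    (hv : ∀ i, Measurable (v i)) (i : ι) (t : ℝ) :
    (v i t + ∑ j, lconvolution (renewal K i j) (v j) volume t) =
      v i t + ∑ j, lconvolution (K i j)
        (fun s => v j s + ∑ l, lconvolution (renewal K j l) (v l) volume s) volume t := by
  have hR := measurable_renewal hK
  have e1 : ∀ j, lconvolution (renewal K i j) (v j) volume t
      = lconvolution (K i j) (v j) volume t +
        ∑ l, lconvolution (K i l) (lconvolution (renewal K l j) (v j) volume) volume t := fun j => by
    have : renewal K i j = fun s => K i j s + ∑ l, lconvolution (K i l) (renewal K l j) volume s :=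
      funext (renewal_eq hK i j)
    conv_lhs => rw [this]
    rw [lconvolution_add_left (hK i j) (hv j),
      lconvolution_sum_left (fun l => measurable_lconvolution _ (hK i l) (hR l j)) (hv j)]
    simp only
    refine congrArg _ (Finset.sum_congr rfl fun l _ => ?_)
    rw [lconvolution_assoc (hK i l) (hR l j) (hv j)]
  have e2 : ∀ j, lconvolution (K i j)
      (fun s => v j s + ∑ l, lconvolution (renewal K j l) (v l) volume s) volume t
      = lconvolution (K i j) (v j) volume t +
        ∑ l, lconvolution (K i j) (lconvolution (renewal K j l) (v l) volume) volume t := fun j => by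
    rw [lconvolution_add_right (hK i j) (hv j),
      lconvolution_sum_right (hK i j) fun l => measurable_lconvolution _ (hR j l) (hv l)]
  simp_rw [e1, e2, Finset.sum_add_distrib]
  rw [Finset.sum_comm]

theorem measurable_renewal_solution (hK : ∀ i j, Measurable (K i j)) {v : ι → ℝ → ℝ≥0∞}
    (hv : ∀ i, Measurable (v i)) (i : ι) :
    Measurable fun t => v i t + ∑ j, lconvolution (renewal K i j) (v j) volume t :=
  (hv i).add (Finset.measurable_sum _ fun j _ =>
    measurable_lconvolution _ (measurable_renewal hK i j) (hv j))

theorem windowSup_renewal_solution_ne_top (hK : ∀ i j, Measurable (K i j))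
    (h0 : ∀ i j, 0 ≤ G i j) (hG : ∀ x ∈ spectrum ℂ (G.map Complex.ofReal), ‖x‖ < 1)
    (hKG : ∀ i j, ∫⁻ t, K i j t = ENNReal.ofReal (G i j)) {v : ι → ℝ → ℝ≥0∞}
    (hv : ∀ i, Measurable (v i)) (hfin : ∀ i, windowSup (volume.withDensity (v i)) ≠ ∞) (i : ι) :
    windowSup (volume.withDensity
      fun t => v i t + ∑ j, lconvolution (renewal K i j) (v j) volume t) ≠ ∞ := by
  have h1 : (volume.withDensity fun t => v i t + ∑ j, lconvolution (renewal K i j) (v j) volume t)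
      = volume.withDensity (v i) +
        volume.withDensity fun t => ∑ j, lconvolution (renewal K i j) (v j) volume t := by
    rw [← withDensity_add_left (hv i)]; rfl
  rw [h1]
  refine ne_top_of_le_ne_top ?_ ((windowSup_add_le _ _).trans (add_le_add le_rfl
    (windowSup_matrix_lconvolution_le (measurable_renewal hK) hv i)))
  exact ENNReal.add_ne_top.2 ⟨hfin i, ENNReal.sum_ne_top.2 fun j _ => ENNReal.mul_ne_top
    (lintegral_renewal_ne_top hK h0 hG hKG i j) (hfin j)⟩

/-- The solution of the renewal equation with bounded windows is `v + (∑ K^⋆n) ⋆ v`. -/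
theorem eq_renewal_solution (hK : ∀ i j, Measurable (K i j)) (h0 : ∀ i j, 0 ≤ G i j)
    (hG : ∀ x ∈ spectrum ℂ (G.map Complex.ofReal), ‖x‖ < 1)
    (hKG : ∀ i j, ∫⁻ t, K i j t = ENNReal.ofReal (G i j)) {v u : ι → ℝ → ℝ≥0∞}
    (hv : ∀ i, Measurable (v i)) (hvfin : ∀ i, windowSup (volume.withDensity (v i)) ≠ ∞)
    (hu : ∀ i, Measurable (u i)) (hfin : ∀ i, windowSup (volume.withDensity (u i)) ≠ ∞)
    (heq : ∀ i t, u i t = v i t + ∑ j, lconvolution (K i j) (u j) volume t) (i : ι) (t : ℝ) :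
    u i t = v i t + ∑ j, lconvolution (renewal K i j) (v j) volume t :=
  congrFun (congrFun (eq_of_renewal_equation hK h0 hG hKG hu (measurable_renewal_solution hK hv)
    hfin (windowSup_renewal_solution_ne_top hK h0 hG hKG hv hvfin) heq
    (renewal_solution hK hv)) i) t

end Renewal

/-! ### The transform on the closed lower half plane and its injectivity. -/

section Laplace

variable {f g : ℝ → ℝ} {z : ℂ}

theorem norm_weight (z : ℂ) (t : ℝ) :
    ‖Complex.exp (-(Complex.I * z * (t : ℂ)))‖ = Real.exp (z.im * t) := by
  rw [Complex.norm_exp]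
  congr 1
  simp [Complex.mul_re, Complex.mul_im]

theorem norm_weight_mul_le (hz : z.im ≤ 0) (hf : ∀ t < 0, f t = 0) (t : ℝ) :
    ‖Complex.exp (-(Complex.I * z * (t : ℂ))) * (f t : ℂ)‖ ≤ ‖f t‖ := by
  rw [norm_mul, norm_weight, Complex.norm_real]
  rcases lt_or_ge t 0 with ht | ht
  · simp [hf t ht]
  · exact mul_le_of_le_one_left (norm_nonneg _)
      (Real.exp_le_one_iff.2 (mul_nonpos_of_nonpos_of_nonneg hz ht))

theorem aestronglyMeasurable_weight_mul {ν : Measure ℝ} (hf : AEStronglyMeasurable f ν) :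
    AEStronglyMeasurable (fun t : ℝ => Complex.exp (-(Complex.I * z * (t : ℂ))) * (f t : ℂ)) ν :=
  (by fun_prop : Continuous fun t : ℝ =>
    Complex.exp (-(Complex.I * z * (t : ℂ)))).aestronglyMeasurable.mul
    (Complex.continuous_ofReal.comp_aestronglyMeasurable hf)

theorem integrable_weight_mul {ν : Measure ℝ} (hz : z.im ≤ 0) (hi : Integrable f ν)
    (hf : ∀ t < 0, f t = 0) :
    Integrable (fun t : ℝ => Complex.exp (-(Complex.I * z * (t : ℂ))) * (f t : ℂ)) ν :=
  hi.mono (aestronglyMeasurable_weight_mul hi.1)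
    (Filter.Eventually.of_forall (norm_weight_mul_le hz hf))

/-- On the real axis the weight has modulus one, so causality is not needed. Injectivity and the
convolutions with `dA` use only this axis. -/
theorem integrable_weight_mul_of_real {ν : Measure ℝ} (x : ℝ) (hi : Integrable f ν) :
    Integrable (fun t : ℝ => Complex.exp (-(Complex.I * (x : ℂ) * (t : ℂ))) * (f t : ℂ)) ν :=
  hi.mono (aestronglyMeasurable_weight_mul hi.1) (Filter.Eventually.of_forall fun t => by
    rw [norm_mul, norm_weight, Complex.norm_real]; simp)

theorem norm_laplace_le (hz : z.im ≤ 0) (hi : Integrable f) (hf : ∀ t < 0, f t = 0) :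
    ‖laplace f z‖ ≤ ∫ t, ‖f t‖ :=
  norm_integral_le_of_norm_le hi.norm (Filter.Eventually.of_forall (norm_weight_mul_le hz hf))

theorem laplace_congr (h : f =ᵐ[volume] g) : laplace f = laplace g := by
  funext z
  refine integral_congr_ae ?_
  filter_upwards [h] with t ht
  rw [ht]

theorem laplace_zero_right (f : ℝ → ℝ) : laplace f 0 = ((∫ t, f t : ℝ) : ℂ) := by
  simp [laplace, integral_complex_ofReal]

/-- The exponential splits as `e^{-izs} e^{-iz(t-s)}`, so the weighted convolution is the
convolution of the weighted functions. The general `ν` covers both Lebesgue measure and, with `f =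
1`, the measures `dA`. -/
theorem laplace_convolution {ν : Measure ℝ} [SFinite ν]
    (hf : Integrable (fun t : ℝ => Complex.exp (-(Complex.I * z * (t : ℂ))) * (f t : ℂ)) ν)
    (hg : Integrable (fun t : ℝ => Complex.exp (-(Complex.I * z * (t : ℂ))) * (g t : ℂ))) :
    laplace (convolution f g (ContinuousLinearMap.mul ℝ ℝ) ν) z =
      (∫ t, Complex.exp (-(Complex.I * z * (t : ℂ))) * (f t : ℂ) ∂ν) * laplace g z := by
  have h := integral_convolution (ContinuousLinearMap.mul ℝ ℂ) hf hg
  rw [ContinuousLinearMap.mul_apply'] at h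
  rw [laplace, laplace, ← h]
  refine integral_congr_ae (Filter.Eventually.of_forall fun t => ?_)
  simp only [convolution, ContinuousLinearMap.mul_apply']
  rw [← integral_complex_ofReal, ← integral_const_mul]
  refine integral_congr_ae (Filter.Eventually.of_forall fun s => ?_)
  have he : Complex.exp (-(Complex.I * z * (t : ℂ))) = Complex.exp (-(Complex.I * z * (s : ℂ))) *
      Complex.exp (-(Complex.I * z * ((t - s : ℝ) : ℂ))) := by
    rw [← Complex.exp_add]; congr 1; push_cast; ring
  simp only [he]
  push_cast
  ring

theorem laplace_conv (hz : z.im ≤ 0) (hi : Integrable f) (hf : ∀ t < 0, f t = 0)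
    (hi' : Integrable g) (hg : ∀ t < 0, g t = 0) :
    laplace (conv f g) z = laplace f z * laplace g z :=
  laplace_convolution (integrable_weight_mul hz hi hf) (integrable_weight_mul hz hi' hg)

theorem laplace_conv_of_real (x : ℝ) (hi : Integrable f) (hi' : Integrable g) :
    laplace (conv f g) x = laplace f x * laplace g x :=
  laplace_convolution (integrable_weight_mul_of_real x hi) (integrable_weight_mul_of_real x hi')

theorem integrable_conv (hi : Integrable f) (hi' : Integrable g) : Integrable (conv f g) :=
  hi.integrable_convolution _ hi'

theorem conv_of_neg (hf : ∀ t < 0, f t = 0) (hg : ∀ t < 0, g t = 0) {t : ℝ} (ht : t < 0) :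
    conv f g t = 0 := by
  refine integral_eq_zero_of_ae (Filter.Eventually.of_forall fun s => ?_)
  rcases lt_or_ge s 0 with hs | hs
  · simp [hf s hs]
  · simp [hg (t - s) (by linarith)]

theorem laplace_add (hf : Integrable fun t : ℝ => Complex.exp (-(Complex.I * z * (t : ℂ))) * f t)
    (hg : Integrable fun t : ℝ => Complex.exp (-(Complex.I * z * (t : ℂ))) * g t) :
    laplace (fun t => f t + g t) z = laplace f z + laplace g z := by
  rw [laplace, laplace, laplace, ← integral_add hf hg]
  exact integral_congr_ae (Filter.Eventually.of_forall fun t => by push_cast; ring)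

theorem laplace_sub (hf : Integrable fun t : ℝ => Complex.exp (-(Complex.I * z * (t : ℂ))) * f t)
    (hg : Integrable fun t : ℝ => Complex.exp (-(Complex.I * z * (t : ℂ))) * g t) :
    laplace (fun t => f t - g t) z = laplace f z - laplace g z := by
  rw [laplace, laplace, laplace, ← integral_sub hf hg]
  exact integral_congr_ae (Filter.Eventually.of_forall fun t => by push_cast; ring)

theorem HasLaplace.add {F F' : ℂ → ℂ} (h : HasLaplace f F) (h' : HasLaplace g F') :
    HasLaplace (fun t => f t + g t) (fun z => F z + F' z) where
  integrable := h.integrable.add h'.integrable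
  causal t ht := by rw [h.causal t ht, h'.causal t ht, add_zero]
  transform z hz := by
    rw [laplace_add (integrable_weight_mul hz h.integrable h.causal)
      (integrable_weight_mul hz h'.integrable h'.causal), h.transform z hz, h'.transform z hz]

theorem HasLaplace.sub {F F' : ℂ → ℂ} (h : HasLaplace f F) (h' : HasLaplace g F') :
    HasLaplace (fun t => f t - g t) (fun z => F z - F' z) where
  integrable := h.integrable.sub h'.integrable
  causal t ht := by rw [h.causal t ht, h'.causal t ht, sub_zero]
  transform z hz := by
    rw [laplace_sub (integrable_weight_mul hz h.integrable h.causal)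
      (integrable_weight_mul hz h'.integrable h'.causal), h.transform z hz, h'.transform z hz]

theorem HasLaplace.mul {F F' : ℂ → ℂ} (h : HasLaplace f F) (h' : HasLaplace g F') :
    HasLaplace (conv f g) (fun z => F z * F' z) where
  integrable := integrable_conv h.integrable h'.integrable
  causal _ ht := conv_of_neg h.causal h'.causal ht
  transform z hz := by
    rw [laplace_conv hz h.integrable h.causal h'.integrable h'.causal, h.transform z hz,
      h'.transform z hz]

theorem HasLaplace.congr {F F' : ℂ → ℂ} (h : HasLaplace f F) (hF : ∀ z : ℂ, z.im ≤ 0 → F z = F' z) :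
    HasLaplace f F' :=
  ⟨h.integrable, h.causal, fun z hz => (h.transform z hz).trans (hF z hz)⟩

theorem IsKernel.hasLaplace (h : IsKernel f) : HasLaplace f (laplace f) :=
  ⟨h.integrable, h.causal, fun _ _ => rfl⟩

/-- The positive and negative parts of `f` are densities of two finite measures with the same
characteristic function, hence of the same measure. -/
theorem ae_eq_zero_of_laplace_eq_zero (hi : Integrable f)
    (h : ∀ x : ℝ, laplace f x = 0) : f =ᵐ[volume] 0 := by
  have hp : AEMeasurable (fun t => ENNReal.ofReal (f t)) := hi.aemeasurable.ennreal_ofReal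
  have hn : AEMeasurable (fun t => ENNReal.ofReal (-f t)) := hi.neg.aemeasurable.ennreal_ofReal
  have hpf : ∫⁻ t, ENNReal.ofReal (f t) ≠ ∞ := (Integrable.lintegral_lt_top hi).ne
  have hnf : ∫⁻ t, ENNReal.ofReal (-f t) ≠ ∞ := (Integrable.lintegral_lt_top hi.neg).ne
  have _ := isFiniteMeasure_withDensity hpf
  have _ := isFiniteMeasure_withDensity hnf
  have hpi : Integrable fun t => max (f t) 0 := hi.pos_part
  have hni : Integrable fun t => max (-f t) 0 := hi.neg_part
  have hchar : ∀ (g : ℝ → ℝ), AEMeasurable (fun t => ENNReal.ofReal (g t)) →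
      ∀ x, charFun (volume.withDensity fun t => ENNReal.ofReal (g t)) x
        = laplace (fun t => max (g t) 0) ((-x : ℝ) : ℂ) := fun g hg x => by
    rw [charFun_apply_real, integral_withDensity_eq_integral_toReal_smul₀ hg
      (Filter.Eventually.of_forall fun t => ENNReal.ofReal_lt_top), laplace]
    refine integral_congr_ae (Filter.Eventually.of_forall fun t => ?_)
    simp only [ENNReal.toReal_ofReal', Complex.real_smul]
    rw [mul_comm]
    congr 2
    push_cast
    ring
  have heq : (volume.withDensity fun t => ENNReal.ofReal (f t))
      = volume.withDensity fun t => ENNReal.ofReal (-f t) := by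
    refine Measure.ext_of_charFun (funext fun x => ?_)
    rw [hchar f hp, hchar (fun t => -f t) hn, ← sub_eq_zero, ← laplace_sub
      (integrable_weight_mul_of_real _ hpi) (integrable_weight_mul_of_real _ hni), ← h (-x)]
    congr 1
    funext t
    exact posPart_sub_negPart (f t)
  have hae := (withDensity_eq_iff hp hn hpf).1 heq
  filter_upwards [hae] with t ht
  rcases le_total (f t) 0 with h0 | h0
  · rw [ENNReal.ofReal_of_nonpos h0] at ht
    have := ENNReal.ofReal_eq_zero.1 ht.symm
    simp only [Pi.zero_apply]
    linarith
  · rw [ENNReal.ofReal_of_nonpos (neg_nonpos.2 h0)] at ht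
    have := ENNReal.ofReal_eq_zero.1 ht
    simp only [Pi.zero_apply]
    linarith

/-- An integrable function is determined by the values of its transform on the real axis. -/
theorem ae_eq_of_laplace_eq (hi : Integrable f) (hi' : Integrable g)
    (h : ∀ x : ℝ, laplace f x = laplace g x) : f =ᵐ[volume] g := by
  have := ae_eq_zero_of_laplace_eq_zero (hi.sub hi') fun x =>
    (laplace_sub (integrable_weight_mul_of_real x hi) (integrable_weight_mul_of_real x hi')).trans
      (sub_eq_zero.2 (h x))
  filter_upwards [this] with t ht
  exact sub_eq_zero.1 ht

theorem HasLaplace.ae_eq {F : ℂ → ℂ} (h : HasLaplace f F) (h' : HasLaplace g F) :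
    f =ᵐ[volume] g :=
  ae_eq_of_laplace_eq h.integrable h'.integrable fun x => by
    rw [h.transform x (by simp), h'.transform x (by simp)]

end Laplace

/-! ### Point processes as s-finite kernels, their mean measures, and predictability. -/

section PointKernels

open ProbabilityTheory (Kernel IsSFiniteKernel IsFiniteKernel)

variable {Ω : Type*} {m : MeasurableSpace Ω}

theorem IsCounting.lt_top {ν : Measure ℝ} (h : IsCounting ν) (s t : ℝ) : ν (Ioc s t) < ∞ := by
  obtain ⟨n, hn⟩ := h s t
  rw [hn]
  exact ENNReal.natCast_lt_top n

theorem pairwise_disjoint_window :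
    Pairwise (Function.onFun Disjoint fun k : ℤ => Ioc ((k : ℝ) - 1) k) := by
  intro k l hkl
  refine Set.disjoint_left.2 fun x hk hl => hkl ?_
  rw [← (Int.ceil_eq_iff.2 hk), ← (Int.ceil_eq_iff.2 hl)]

theorem sum_restrict_window (ν : Measure ℝ) :
    Measure.sum (fun k : ℤ => ν.restrict (Ioc ((k : ℝ) - 1) k)) = ν := by
  rw [← Measure.restrict_iUnion pairwise_disjoint_window fun _ => measurableSet_Ioc,
    iUnion_window, Measure.restrict_univ]

/-- A random locally finite measure is measurable as soon as its masses of intervals are. -/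
theorem measurable_of_isCounting {N : Ω → Measure ℝ} (hN : ∀ ω, IsCounting (N ω))
    (hmeas : ∀ s t, Measurable fun ω => N ω (Ioc s t)) : Measurable N := by
  have h1 : ∀ k : ℤ, Measurable fun ω => (N ω).restrict (Ioc ((k : ℝ) - 1) k) := fun k => by
    have _ : ∀ ω, IsFiniteMeasure ((N ω).restrict (Ioc ((k : ℝ) - 1) k)) := fun ω =>
      ⟨by rw [Measure.restrict_apply_univ]; exact (hN ω).lt_top _ _⟩
    refine Measurable.measure_of_isPiSystem
      (BorelSpace.measurable_eq.trans (borel_eq_generateFrom_Ioc ℝ))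
      (isPiSystem_Ioc (id : ℝ → ℝ) (id : ℝ → ℝ)) ?_ ?_
    · rintro _ ⟨a, b, -, rfl⟩
      simp_rw [Measure.restrict_apply measurableSet_Ioc, Ioc_inter_Ioc]
      exact hmeas _ _
    · simp_rw [Measure.restrict_apply_univ]
      exact hmeas _ _
  refine Measure.measurable_of_measurable_coe _ fun s hs => ?_
  have h2 : (fun ω => N ω s) = fun ω => ∑' k : ℤ, (N ω).restrict (Ioc ((k : ℝ) - 1) k) s := by
    funext ω
    rw [← Measure.sum_apply _ hs, sum_restrict_window]
  rw [h2]
  exact Measurable.tsum fun k => (Measure.measurable_coe hs).comp (h1 k)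

/-- No bound on the number of points is uniform in `ω`, so the kernel is cut twice: by the unit
window `k`, and by the event that this window holds exactly `n` points. Each piece has mass at most
`n`. -/
theorem isSFiniteKernel_of_isCounting (κ : Kernel Ω ℝ) (h : ∀ ω, IsCounting (κ ω)) :
    IsSFiniteKernel κ := by
  classical
  have hA : ∀ p : ℤ × ℕ, MeasurableSet {ω | κ ω (Ioc ((p.1 : ℝ) - 1) p.1) = p.2} := fun p =>
    (Kernel.measurable_coe κ measurableSet_Ioc) (measurableSet_singleton _)
  let η : ℤ × ℕ → Kernel Ω ℝ := fun p =>
    Kernel.piecewise (hA p) (κ.restrict (measurableSet_Ioc (a := (p.1 : ℝ) - 1) (b := p.1))) 0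
  have hη : ∀ p, IsFiniteKernel (η p) := fun p => by
    refine ⟨⟨p.2, ENNReal.natCast_lt_top _, fun ω => ?_⟩⟩
    simp only [η, Kernel.piecewise_apply]
    split_ifs with hω
    · rw [Kernel.restrict_apply, Measure.restrict_apply_univ]
      exact le_of_eq hω
    · simp
  have hsum : κ = Kernel.sum η := by
    ext ω s hs
    rw [Kernel.sum_apply' _ _ hs, ENNReal.tsum_prod (f := fun k n => η (k, n) ω s)]
    conv_lhs => rw [← sum_restrict_window (κ ω), Measure.sum_apply _ hs]
    refine tsum_congr fun k => ?_
    obtain ⟨n, hn⟩ := h ω ((k : ℝ) - 1) k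
    rw [tsum_eq_single n]
    · simp only [η, Kernel.piecewise_apply, mem_ofPred_eq, hn, if_true, Kernel.restrict_apply]
    · intro n' hn'
      have : ¬ ((n : ℝ≥0∞) = n') := fun h => hn' (by exact_mod_cast h.symm)
      simp only [η, Kernel.piecewise_apply, mem_ofPred_eq, hn, this, if_false]
      simp
  rw [hsum]
  exact Kernel.isSFiniteKernel_sum (hκs := fun p => by have := hη p; infer_instance)

/-- The mean of the random measure `κ`, restricted to the random set `S`. -/
noncomputable def meanOn (ℙ : Measure Ω) (κ : Kernel Ω ℝ) (S : Set (ℝ × Ω)) : Measure ℝ :=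
  ((ℙ.compProd κ).restrict (Prod.swap ⁻¹' S)).map Prod.snd

variable (ℙ : Measure Ω) [IsProbabilityMeasure ℙ] (κ : Kernel Ω ℝ)

instance sFinite_meanOn (S : Set (ℝ × Ω)) : SFinite (meanOn ℙ κ S) := by unfold meanOn; infer_instance

variable [IsSFiniteKernel κ] {S : Set (ℝ × Ω)}

theorem lintegral_meanOn (hS : MeasurableSet S) {F : ℝ → ℝ≥0∞} (hF : Measurable F) :
    ∫⁻ t, F t ∂(meanOn ℙ κ S) =
      ∫⁻ ω, ∫⁻ t, S.indicator 1 (t, ω) * F t ∂(κ ω) ∂ℙ := by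
  have hS' : MeasurableSet (Prod.swap ⁻¹' S : Set (Ω × ℝ)) := measurable_swap hS
  rw [meanOn, lintegral_map hF measurable_snd, ← lintegral_indicator hS',
    Measure.lintegral_compProd
      ((by fun_prop : Measurable fun a : Ω × ℝ => F a.2).indicator hS')]
  refine lintegral_congr fun ω => lintegral_congr fun t => ?_
  by_cases h : (t, ω) ∈ S
  · rw [indicator_of_mem (by exact h), indicator_of_mem h]; simp
  · rw [indicator_of_notMem (by exact h), indicator_of_notMem h]; simp

theorem meanOn_univ_apply {B : Set ℝ} (hB : MeasurableSet B) :
    meanOn ℙ κ univ B = ∫⁻ ω, κ ω B ∂ℙ := by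
  rw [← lintegral_indicator_one hB,
    lintegral_meanOn ℙ κ MeasurableSet.univ (measurable_one.indicator hB)]
  simp [lintegral_indicator_one hB]

/-- Since `F` and `H` are deterministic, Tonelli moves the expectation onto the random measure,
which enters linearly and becomes its mean. -/
theorem lintegral_lintegral_mconv (hS : MeasurableSet S) {F H : ℝ → ℝ≥0∞} (hF : Measurable F)
    (hH : Measurable H) :
    ∫⁻ ω, (∫⁻ t : ℝ, H t * ∫⁻ s, S.indicator 1 (s, ω) * F (t - s) ∂(κ ω)) ∂ℙ =
      ∫⁻ t, H t * mconv F (meanOn ℙ κ S) t := by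
  rw [lintegral_mul_mconv hF hH, lintegral_meanOn ℙ κ hS
    (Measurable.lintegral_prod_left' (f := fun p : ℝ × ℝ => H p.1 * F (p.1 - p.2)) (by fun_prop))]
  refine lintegral_congr fun ω => ?_
  have hI : Measurable fun s : ℝ => S.indicator (1 : ℝ × Ω → ℝ≥0∞) (s, ω) :=
    (measurable_one.indicator hS).comp (measurable_id.prodMk measurable_const)
  have e : ∀ t, H t * ∫⁻ s, S.indicator 1 (s, ω) * F (t - s) ∂(κ ω) =
      ∫⁻ s, H t * (S.indicator 1 (s, ω) * F (t - s)) ∂(κ ω) := fun t =>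
    (lintegral_const_mul _ (by fun_prop)).symm
  simp_rw [e]
  rw [lintegral_lintegral_swap (by fun_prop)]
  refine lintegral_congr fun s => ?_
  rw [← lintegral_const_mul _ (by fun_prop)]
  exact lintegral_congr fun t => by ring

theorem lintegral_mconv_kernel {F : ℝ → ℝ≥0∞} (hF : Measurable F) (t : ℝ) :
    ∫⁻ ω, mconv F (κ ω) t ∂ℙ = mconv F (meanOn ℙ κ univ) t := by
  rw [mconv, lintegral_meanOn ℙ κ MeasurableSet.univ (by fun_prop)]
  simp [mconv]

theorem measurable_mconv_kernel {F : ℝ → ℝ≥0∞} (hF : Measurable F) :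
    Measurable fun p : ℝ × Ω => mconv F (κ p.2) p.1 := by
  have := Measurable.lintegral_kernel_prod_right' (κ := Kernel.prodMkLeft ℝ κ)
    (f := fun q : (ℝ × Ω) × ℝ => F (q.1.1 - q.2)) (by fun_prop)
  simpa [mconv] using this

variable {κ}

theorem measurable_predictable_fst (𝓕 : Filtration ℝ m) :
    Measurable[predictable 𝓕] (Prod.fst : ℝ × Ω → ℝ) := by
  have h : Real.measurableSpace = MeasurableSpace.generateFrom (range Ioi) :=
    BorelSpace.measurable_eq.trans (borel_eq_generateFrom_Ioi ℝ)
  refine (@measurable_generateFrom _ _ (predictable 𝓕) _ _ ?_).mono le_rfl h.le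
  rintro _ ⟨a, rfl⟩
  exact MeasurableSpace.measurableSet_generateFrom
    ⟨a, univ, MeasurableSet.univ, by ext p; simp⟩

theorem predictable_le (𝓕 : Filtration ℝ m) :
    predictable 𝓕 ≤ (inferInstance : MeasurableSpace (ℝ × Ω)) := by
  refine MeasurableSpace.generateFrom_le ?_
  rintro _ ⟨s, F, hF, rfl⟩
  exact measurableSet_Ioi.prod (𝓕.le s F hF)

end PointKernels

/-! ### A priori bounds for the mean measure by localization. -/

section MeanMeasure

set_option linter.unusedSectionVars false

open ProbabilityTheory (Kernel IsSFiniteKernel IsFiniteKernel)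

variable {Ω : Type*} {m : MeasurableSpace Ω} {ℙ : Measure Ω} [IsProbabilityMeasure ℙ]
  {𝓕 : Filtration ℝ m} {ι : Type*} [Fintype ι] {κ : ι → Kernel Ω ℝ}
  [∀ i, IsSFiniteKernel (κ i)] {K : ι → ι → ℝ → ℝ≥0∞} {v : ι → ℝ → ℝ≥0∞} {S : Set (ℝ × Ω)}

theorem measurable_indicator_kernel (κ : Kernel Ω ℝ) [IsSFiniteKernel κ] (hS : MeasurableSet S)
    {F : ℝ → ℝ≥0∞} (hF : Measurable F) :
    Measurable fun p : ℝ × Ω => ∫⁻ s, S.indicator 1 (s, p.2) * F (p.1 - s) ∂(κ p.2) := by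
  have hI : Measurable fun q : (ℝ × Ω) × ℝ =>
      S.indicator (1 : ℝ × Ω → ℝ≥0∞) (q.2, q.1.2) * F (q.1.1 - q.2) :=
    ((measurable_one.indicator hS).comp (by fun_prop : Measurable fun q : (ℝ × Ω) × ℝ =>
      ((q.2, q.1.2) : ℝ × Ω))).mul (by fun_prop)
  simpa using Measurable.lintegral_kernel_prod_right' (κ := Kernel.prodMkLeft ℝ κ) hI

theorem lintegral_indicator_mul_intensity (hK : ∀ i j, Measurable (K i j))
    (hv : ∀ i, Measurable (v i)) (hS : MeasurableSet S) {B : Set ℝ} (hB : MeasurableSet B) (i : ι) :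
    ∫⁻ ω, (∫⁻ t : ℝ, B.indicator 1 t *
      (v i t + ∑ j, ∫⁻ s, S.indicator 1 (s, ω) * K i j (t - s) ∂(κ j ω))) ∂ℙ =
      volume.withDensity (fun t => v i t + ∑ j, mconv (K i j) (meanOn ℙ (κ j) S) t) B := by
  have hBm : Measurable (B.indicator (1 : ℝ → ℝ≥0∞)) := measurable_one.indicator hB
  have hBv : Measurable fun t => B.indicator (1 : ℝ → ℝ≥0∞) t * v i t := hBm.mul (hv i)
  have hBk : ∀ j, Measurable fun t => B.indicator (1 : ℝ → ℝ≥0∞) t *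
      mconv (K i j) (meanOn ℙ (κ j) S) t := fun j => hBm.mul (measurable_mconv (hK i j))
  have hm : ∀ j, Measurable fun p : ℝ × Ω => B.indicator (1 : ℝ → ℝ≥0∞) p.1 *
      ∫⁻ s, S.indicator 1 (s, p.2) * K i j (p.1 - s) ∂(κ j p.2) := fun j =>
    (hBm.comp measurable_fst).mul (measurable_indicator_kernel (κ j) hS (hK i j))
  have hm' : ∀ j ω, Measurable fun t : ℝ => B.indicator (1 : ℝ → ℝ≥0∞) t *
      ∫⁻ s, S.indicator 1 (s, ω) * K i j (t - s) ∂(κ j ω) := fun j ω =>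
    (hm j).comp (measurable_id.prodMk measurable_const)
  have e1 : ∀ ω, ∫⁻ t : ℝ, B.indicator 1 t *
      (v i t + ∑ j, ∫⁻ s, S.indicator 1 (s, ω) * K i j (t - s) ∂(κ j ω)) =
      (∫⁻ t, B.indicator 1 t * v i t) + ∑ j, ∫⁻ t : ℝ, B.indicator 1 t *
        ∫⁻ s, S.indicator 1 (s, ω) * K i j (t - s) ∂(κ j ω) := fun ω => by
    simp_rw [mul_add, Finset.mul_sum]
    rw [lintegral_add_left hBv, lintegral_finsetSum _ fun j _ => hm' j ω]
  simp_rw [e1]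
  rw [lintegral_add_left measurable_const, lintegral_finsetSum _ fun j _ =>
    Measurable.lintegral_prod_left' (hm j), lintegral_const, measure_univ, mul_one]
  simp_rw [lintegral_lintegral_mconv ℙ (κ _) hS (hK i _) hBm]
  rw [withDensity_apply _ hB, ← lintegral_indicator hB]
  have e2 : ∀ t, B.indicator (fun t => v i t + ∑ j, mconv (K i j) (meanOn ℙ (κ j) S) t) t =
      B.indicator 1 t * v i t + ∑ j, B.indicator 1 t * mconv (K i j) (meanOn ℙ (κ j) S) t :=
    fun t => by by_cases ht : t ∈ B <;> simp [ht]
  simp_rw [e2]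
  rw [lintegral_add_left hBv, lintegral_finsetSum _ fun j _ =>
    hBk j]

/-- The definition of the intensity is tested against the predictable process `1_S 1_B`. -/
theorem meanOn_apply_of_hasIntensity
    (hInt : ∀ i, HasIntensity ℙ 𝓕 (fun ω => κ i ω)
      (fun t ω => v i t + ∑ j, mconv (K i j) (κ j ω) t))
    (hS : MeasurableSet[predictable 𝓕] S) {B : Set ℝ} (hB : MeasurableSet B) (i : ι) :
    meanOn ℙ (κ i) S B = ∫⁻ ω, (∫⁻ t : ℝ, S.indicator 1 (t, ω) * B.indicator 1 t *
      (v i t + ∑ j, mconv (K i j) (κ j ω) t)) ∂ℙ := by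
  rw [← lintegral_indicator_one hB, lintegral_meanOn ℙ (κ i) (predictable_le 𝓕 S hS)
    (measurable_one.indicator hB)]
  refine hInt i (fun p => S.indicator 1 p * B.indicator 1 p.1) ?_
  refine @Measurable.mul _ _ _ _ (predictable 𝓕) _ _ _ ?_ ?_
  · have h1 : Measurable[predictable 𝓕] (1 : ℝ × Ω → ℝ≥0∞) :=
      @measurable_one _ _ _ (predictable 𝓕) _
    exact h1.indicator hS
  · exact (measurable_one.indicator hB : Measurable (B.indicator (1 : ℝ → ℝ≥0∞))).comp
      (measurable_predictable_fst 𝓕)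

/-- If `t` belongs to `S`, so do all earlier times, and the causal kernels see only those. The
intensity on `S` is therefore produced by the points in `S` alone, and the inequality closes on the
restricted means. -/
theorem meanOn_le_of_hasIntensity (hK : ∀ i j, Measurable (K i j))
    (hcausal : ∀ i j, ∀ t ≤ 0, K i j t = 0) (hv : ∀ i, Measurable (v i))
    (hInt : ∀ i, HasIntensity ℙ 𝓕 (fun ω => κ i ω)
      (fun t ω => v i t + ∑ j, mconv (K i j) (κ j ω) t))
    (hS : MeasurableSet[predictable 𝓕] S)
    (hdown : ∀ s t ω, s < t → (t, ω) ∈ S → (s, ω) ∈ S) (i : ι) :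
    meanOn ℙ (κ i) S ≤
      volume.withDensity (fun t => v i t + ∑ j, mconv (K i j) (meanOn ℙ (κ j) S) t) := by
  refine Measure.le_iff.2 fun B hB => ?_
  rw [meanOn_apply_of_hasIntensity hInt hS hB,
    ← lintegral_indicator_mul_intensity hK hv (predictable_le 𝓕 S hS) hB]
  refine lintegral_mono fun ω => lintegral_mono fun t => ?_
  simp only
  by_cases ht : (t, ω) ∈ S
  · rw [indicator_of_mem ht, Pi.one_apply, one_mul]
    gcongr with j
    refine lintegral_mono fun s => ?_
    simp only
    rcases lt_or_ge s t with hs | hs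
    · rw [indicator_of_mem (hdown s t ω hs ht)]; simp
    · rw [hcausal i j (t - s) (by linarith)]; simp
  · rw [indicator_of_notMem ht]; simp

theorem meanOn_univ_eq_withDensity (hK : ∀ i j, Measurable (K i j)) (hv : ∀ i, Measurable (v i))
    (hInt : ∀ i, HasIntensity ℙ 𝓕 (fun ω => κ i ω)
      (fun t ω => v i t + ∑ j, mconv (K i j) (κ j ω) t)) (i : ι) :
    meanOn ℙ (κ i) univ =
      volume.withDensity (fun t => v i t + ∑ j, mconv (K i j) (meanOn ℙ (κ j) univ) t) := by
  refine Measure.ext fun B hB => ?_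
  rw [meanOn_apply_of_hasIntensity hInt (@MeasurableSet.univ _ (predictable 𝓕)) hB,
    ← lintegral_indicator_mul_intensity hK hv MeasurableSet.univ hB]
  simp [mconv]

theorem lintegral_intensity (hK : ∀ i j, Measurable (K i j)) (i : ι) (t : ℝ) :
    ∫⁻ ω, (v i t + ∑ j, mconv (K i j) (κ j ω) t) ∂ℙ =
      v i t + ∑ j, mconv (K i j) (meanOn ℙ (κ j) univ) t := by
  have hm : ∀ j, Measurable fun ω => mconv (K i j) (κ j ω) t := fun j =>
    (measurable_mconv_kernel (κ j) (hK i j)).comp (measurable_const.prodMk measurable_id)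
  rw [lintegral_add_left measurable_const, lintegral_const, measure_univ, mul_one,
    lintegral_finsetSum _ fun j _ => hm j]
  simp_rw [lintegral_mconv_kernel ℙ (κ _) (hK i _)]

/-- The random interval `(-∞, b] ∩ (-∞, τ]`, where `τ` is the first time after `0` at which one of
the components has more than `n` points. -/
def localizingSet (κ : ι → Kernel Ω ℝ) (b : ℝ) (n : ℕ) : Set (ℝ × Ω) :=
  {p | p.1 ≤ b ∧ ∀ q : ℚ, 0 < (q : ℝ) → (q : ℝ) < p.1 → ∀ i, κ i p.2 (Ioc 0 (q : ℝ)) ≤ n}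

theorem measurableSet_localizingSet (hadapt : ∀ i s t, Measurable[𝓕 t] fun ω => κ i ω (Ioc s t))
    (b : ℝ) (n : ℕ) : MeasurableSet[predictable 𝓕] (localizingSet κ b n) := by
  have hgen : ∀ s F, MeasurableSet[𝓕 s] F → MeasurableSet[predictable 𝓕] (Ioi s ×ˢ F) :=
    fun s F hF => MeasurableSpace.measurableSet_generateFrom ⟨s, F, hF, rfl⟩
  -- Testing rational times makes the complement a countable union of generators of the predictable
  -- σ-algebra.
  have e : localizingSet κ b n = (Ioi b ×ˢ univ ∪ ⋃ q : {q : ℚ // 0 < (q : ℝ)}, ⋃ i,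
      Ioi ((q : ℚ) : ℝ) ×ˢ {ω | (n : ℝ≥0∞) < κ i ω (Ioc 0 ((q : ℚ) : ℝ))})ᶜ := by
    ext ⟨t, ω⟩
    simp only [localizingSet, mem_ofPred_eq, mem_compl_iff, mem_union, mem_prod, mem_Ioi, mem_univ,
      and_true, mem_iUnion, not_or, not_lt, not_exists, not_and, Subtype.forall]
    exact and_congr_right fun _ => forall_congr' fun q =>
      ⟨fun h hq i hqt => h hq hqt i, fun h hq hqt i => h hq i hqt⟩
  rw [e]
  refine @MeasurableSet.compl _ _ (predictable 𝓕) (@MeasurableSet.union _ (predictable 𝓕) _ _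
    (hgen b _ MeasurableSet.univ) (@MeasurableSet.iUnion _ _ (predictable 𝓕) _ _ fun q =>
      @MeasurableSet.iUnion _ _ (predictable 𝓕) _ _ fun i => hgen _ _ ?_))
  exact hadapt i 0 _ measurableSet_Ioi

theorem localizingSet_down {b : ℝ} {n : ℕ} {s t : ℝ} {ω : Ω} (hst : s < t)
    (h : (t, ω) ∈ localizingSet κ b n) : (s, ω) ∈ localizingSet κ b n :=
  ⟨hst.le.trans h.1, fun q hq hqs => h.2 q hq (hqs.trans hst)⟩

theorem localizingSet_mono (b : ℝ) : Monotone (localizingSet κ b) := fun n n' hn _ hp =>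
  ⟨hp.1, fun q hq hqs i => (hp.2 q hq hqs i).trans (by exact_mod_cast hn)⟩

theorem iUnion_localizingSet (hcount : ∀ i ω, IsCounting (κ i ω)) (b : ℝ) :
    ⋃ n, localizingSet κ b n = {p | p.1 ≤ b} := by
  ext ⟨t, ω⟩
  simp only [mem_iUnion, mem_ofPred_eq]
  refine ⟨fun ⟨n, hn⟩ => hn.1, fun ht => ?_⟩
  choose N hN using fun i => hcount i ω 0 b
  -- The total number of points in `(0, b]` bounds every component at once.
  refine ⟨∑ i, N i, ht, fun q _ hqt i => ?_⟩
  refine (measure_mono (Ioc_subset_Ioc_right (hqt.le.trans ht))).trans ?_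
  rw [hN]
  exact_mod_cast Finset.single_le_sum (f := N) (fun j _ => Nat.zero_le _) (Finset.mem_univ i)

/-- The points strictly below the supremum of the set lie in an increasing union of intervals `(0,
q]`, each still subject to the bound `n`. The supremum itself may carry one further point, and no
more because jumps have size at most one. -/
theorem kernel_localizingSet_le {ω : Ω} {i : ι} (hsimple : ∀ t, κ i ω {t} ≤ 1) (b : ℝ) (n : ℕ) :
    κ i ω ({t | (t, ω) ∈ localizingSet κ b n} ∩ Ioi 0) ≤ n + 1 := by
  set A : Set ℝ := {t | (t, ω) ∈ localizingSet κ b n} ∩ Ioi 0 with hA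
  have hbdd : BddAbove A := ⟨b, fun t ht => ht.1.1⟩
  rcases A.eq_empty_or_nonempty with h0 | hne
  · simp [h0]
  have hsub : A ⊆ (⋃ q : {q : ℚ // 0 < (q : ℝ) ∧ (q : ℝ) < sSup A}, Ioc 0 ((q : ℚ) : ℝ)) ∪
      {sSup A} := fun t ht => by
    rcases (le_csSup hbdd ht).lt_or_eq with hlt | heq
    · obtain ⟨q, hq1, hq2⟩ := exists_rat_btwn hlt
      exact Or.inl (mem_iUnion.2 ⟨⟨q, (mem_Ioi.1 ht.2).trans hq1, hq2⟩, ht.2, hq1.le⟩)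
    · exact Or.inr heq
  refine (measure_mono hsub).trans ((measure_union_le _ _).trans (add_le_add ?_ (hsimple _)))
  have hdir : Directed (· ⊆ ·) fun q : {q : ℚ // 0 < (q : ℝ) ∧ (q : ℝ) < sSup A} =>
      Ioc 0 ((q : ℚ) : ℝ) := fun q q' => by
    rcases le_total (q : ℚ) q' with h | h
    · exact ⟨q', Ioc_subset_Ioc_right (by exact_mod_cast h), Subset.rfl⟩
    · exact ⟨q, Subset.rfl, Ioc_subset_Ioc_right (by exact_mod_cast h)⟩
  rw [hdir.measure_iUnion]
  refine iSup_le fun q => ?_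
  obtain ⟨u, hu, hqu⟩ := exists_lt_of_lt_csSup hne q.2.2
  exact hu.1.2 q q.2.1 hqu i

theorem meanOn_apply (κ : Kernel Ω ℝ) [IsSFiniteKernel κ] (hS : MeasurableSet S) {B : Set ℝ}
    (hB : MeasurableSet B) : meanOn ℙ κ S B = ∫⁻ ω, κ ω ({t | (t, ω) ∈ S} ∩ B) ∂ℙ := by
  rw [← lintegral_indicator_one hB, lintegral_meanOn ℙ κ hS (measurable_one.indicator hB)]
  refine lintegral_congr fun ω => ?_
  have hm : MeasurableSet {t | (t, ω) ∈ S} := measurable_prodMk_right hS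
  rw [← lintegral_indicator_one (hm.inter hB)]
  refine lintegral_congr fun t => ?_
  rw [inter_indicator_one]
  rfl

/-- This finiteness, which may depend on `n`, is what allows subinvariance to be applied to the
stopped process. -/
theorem windowSup_meanOn_localizingSet_ne_top
    (hadapt : ∀ i s t, Measurable[𝓕 t] fun ω => κ i ω (Ioc s t))
    (hsimple : ∀ i, ∀ᵐ ω ∂ℙ, ∀ t, κ i ω {t} ≤ 1) {C : ℝ≥0∞} (hC : C ≠ ∞)
    (hpast : ∀ i, ∀ t ≤ 0, ∫⁻ ω, κ i ω (Ioc (t - 1) t) ∂ℙ ≤ C) (b : ℝ) (n : ℕ) (i : ι) :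
    windowSup (meanOn ℙ (κ i) (localizingSet κ b n)) ≠ ∞ := by
  have hS := predictable_le 𝓕 _ (measurableSet_localizingSet hadapt b n)
  -- A window is covered by the positive times, with at most `n + 1` points in the stopped process,
  -- and by one window ending at `min a 0`, with mean mass at most `C`.
  refine ne_top_of_le_ne_top (b := (n + 1 + C : ℝ≥0∞)) (by finiteness) (iSup_le fun a => ?_)
  have hsub : Ioc (a - 1) a ⊆ Ioi 0 ∪ Ioc (min a 0 - 1) (min a 0) := fun t ht => by
    rcases lt_or_ge 0 t with h | h
    · exact Or.inl h
    · exact Or.inr ⟨(sub_le_sub_right (min_le_left _ _) _).trans_lt ht.1, le_min ht.2 h⟩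
  refine (measure_mono hsub).trans ((measure_union_le _ _).trans (add_le_add ?_ ?_))
  · rw [meanOn_apply (κ i) hS measurableSet_Ioi]
    refine (lintegral_mono_ae (g := fun _ => (n + 1 : ℝ≥0∞)) ?_).trans (by simp)
    filter_upwards [hsimple i] with ω hω
    exact kernel_localizingSet_le hω b n
  · rw [meanOn_apply (κ i) hS measurableSet_Ioc]
    exact (lintegral_mono fun ω => measure_mono inter_subset_right).trans
      (hpast i _ (min_le_right _ _))

theorem windowSup_add_mconv_le {γ : Type*} [Fintype γ] [DecidableEq γ] {M : γ → Measure ℝ}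
    [∀ j, SFinite (M j)] {k : γ → ℝ → ℝ≥0∞} (hk : ∀ j, Measurable (k j)) {w : ℝ → ℝ≥0∞}
    (hw : Measurable w) :
    windowSup (volume.withDensity (fun t => w t + ∑ j, mconv (k j) (M j) t)) ≤
      windowSup (volume.withDensity w) + ∑ j, (∫⁻ t, k j t) * windowSup (M j) := by
  have h1 : (volume.withDensity fun t => w t + ∑ j, mconv (k j) (M j) t)
      = volume.withDensity w + volume.withDensity fun t => ∑ j, mconv (k j) (M j) t := by
    rw [← withDensity_add_left hw]; rfl
  rw [h1, withDensity_sum_fun fun j => measurable_mconv (hk j)]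
  exact (windowSup_add_le _ _).trans (add_le_add le_rfl ((windowSup_sum_le _ _).trans
    (Finset.sum_le_sum fun j _ => windowSup_withDensity_mconv_le (hk j))))

/-- If the mean number of points per unit of time is bounded on the past, then it is bounded on the
whole time line. -/
theorem windowSup_meanOn_univ_ne_top [DecidableEq ι] {G : Matrix ι ι ℝ} (h0 : ∀ i j, 0 ≤ G i j)
    (hG : ∀ x ∈ spectrum ℂ (G.map Complex.ofReal), ‖x‖ < 1)
    (hK : ∀ i j, Measurable (K i j)) (hKG : ∀ i j, ∫⁻ t, K i j t = ENNReal.ofReal (G i j))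
    (hcausal : ∀ i j, ∀ t ≤ 0, K i j t = 0) (hv : ∀ i, Measurable (v i))
    (hvfin : ∀ i, windowSup (volume.withDensity (v i)) ≠ ∞)
    (hInt : ∀ i, HasIntensity ℙ 𝓕 (fun ω => κ i ω)
      (fun t ω => v i t + ∑ j, mconv (K i j) (κ j ω) t))
    (hcount : ∀ i ω, IsCounting (κ i ω))
    (hadapt : ∀ i s t, Measurable[𝓕 t] fun ω => κ i ω (Ioc s t))
    (hsimple : ∀ i, ∀ᵐ ω ∂ℙ, ∀ t, κ i ω {t} ≤ 1) {C : ℝ≥0∞} (hC : C ≠ ∞)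
    (hpast : ∀ i, ∀ t ≤ 0, ∫⁻ ω, κ i ω (Ioc (t - 1) t) ∂ℙ ≤ C) (i : ι) :
    windowSup (meanOn ℙ (κ i) univ) ≠ ∞ := by
  obtain ⟨β, hβ, hbound⟩ := exists_ennreal_bound h0 hG hvfin
  refine ne_top_of_le_ne_top (hβ i) (iSup_le fun a => ?_)
  have hSn := fun n => measurableSet_localizingSet (𝓕 := 𝓕) hadapt a n
  have hloc : ∀ n, meanOn ℙ (κ i) (localizingSet κ a n) (Ioc (a - 1) a) ≤ β i := fun n => by
    refine (measure_window_le _ _).trans (hbound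
      (fun i => windowSup (meanOn ℙ (κ i) (localizingSet κ a n)))
      (windowSup_meanOn_localizingSet_ne_top hadapt hsimple hC hpast a n) (fun i => ?_) i)
    simp_rw [← hKG]
    exact (windowSup_mono (meanOn_le_of_hasIntensity hK hcausal hv hInt (hSn n)
      (fun s t ω => localizingSet_down) i)).trans (windowSup_add_mconv_le (hK i) (hv i))
  rw [meanOn_apply (κ i) MeasurableSet.univ measurableSet_Ioc]
  have e : ∀ ω, κ i ω ({t | (t, ω) ∈ (univ : Set (ℝ × Ω))} ∩ Ioc (a - 1) a) =
      ⨆ n, κ i ω ({t | (t, ω) ∈ localizingSet κ a n} ∩ Ioc (a - 1) a) := fun ω => by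
    rw [← Monotone.measure_iUnion]
    · congr 1
      rw [← iUnion_inter]
      ext t
      have := congrArg (fun A => (t, ω) ∈ A) (iUnion_localizingSet hcount a)
      simp only [mem_iUnion, mem_ofPred_eq, eq_iff_iff] at this
      simp only [mem_inter_iff, mem_iUnion, mem_ofPred_eq, mem_univ, true_and, this, mem_Ioc]
      tauto
    · exact fun n n' hn => inter_subset_inter_left _ fun t ht => localizingSet_mono a hn ht
  simp_rw [e]
  -- The bound `β` does not depend on `n`, so monotone convergence removes the localization.
  rw [lintegral_iSup]
  · refine iSup_le fun n => ?_
    rw [← meanOn_apply (κ i) (predictable_le 𝓕 _ (hSn n)) measurableSet_Ioc]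
    exact hloc n
  · intro n
    have := Kernel.measurable_kernel_prodMk_left (κ := κ i)
      (measurable_swap ((predictable_le 𝓕 _ (hSn n)).inter (measurable_fst measurableSet_Ioc)) :
        MeasurableSet (Prod.swap ⁻¹' (localizingSet κ a n ∩ Prod.fst ⁻¹' Ioc (a - 1) a)))
    exact this
  · exact fun n n' hn ω => measure_mono
      (inter_subset_inter_left _ fun t ht => localizingSet_mono a hn ht)

end MeanMeasure

/-! ### Kernels restricted to positive times. -/

section CausalPart

/-- The restriction of `f` to positive times, with values in `[0, ∞]`. -/
noncomputable def causalPart (f : ℝ → ℝ) : ℝ → ℝ≥0∞ :=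
  (Ioi 0).indicator fun t => ENNReal.ofReal (f t)

variable {f g : ℝ → ℝ}

theorem measurable_causalPart (hf : Measurable f) : Measurable (causalPart f) :=
  hf.ennreal_ofReal.indicator measurableSet_Ioi

theorem causalPart_of_nonpos {t : ℝ} (ht : t ≤ 0) : causalPart f t = 0 :=
  indicator_of_notMem (notMem_Ioi.2 ht) _

theorem convMeasure_eq_mconv (f : ℝ → ℝ) (ν : Measure ℝ) (t : ℝ) :
    convMeasure f ν t = mconv (causalPart f) ν t := by
  rw [convMeasure, ← lintegral_indicator measurableSet_Iio, mconv]
  refine lintegral_congr fun s => ?_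
  by_cases hs : s < t
  · rw [causalPart, indicator_of_mem (mem_Iio.2 hs), indicator_of_mem (mem_Ioi.2 (sub_pos.2 hs))]
  · rw [causalPart, indicator_of_notMem (by simpa using hs),
      indicator_of_notMem (by simpa using hs)]

/-- Only the value at `0` is lost. It matters against a measure with atoms, where a jump must not
feed the intensity at its own time, but not for masses, transforms or Lebesgue convolutions. -/
theorem IsKernel.causalPart_ae_eq (hf : IsKernel f) :
    causalPart f =ᵐ[volume] fun t => ENNReal.ofReal (f t) := by
  have h0 : ∀ᵐ t : ℝ, t ≠ 0 := by simp [ae_iff]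
  filter_upwards [h0] with t ht
  rcases lt_or_gt_of_ne ht with h | h
  · rw [causalPart_of_nonpos h.le, hf.causal t h, ENNReal.ofReal_zero]
  · exact indicator_of_mem (mem_Ioi.2 h) _

theorem IsKernel.lintegral_causalPart (hf : IsKernel f) :
    ∫⁻ t, causalPart f t = ENNReal.ofReal (∫ t, f t) := by
  rw [lintegral_congr_ae hf.causalPart_ae_eq,
    ofReal_integral_eq_lintegral_ofReal hf.integrable (Filter.Eventually.of_forall hf.nonneg)]

/-- No integrability is required: where the convolution is infinite, both sides take the default
value `0`. -/
theorem conv_eq_toReal_lconvolution (hf : Measurable f) (hg : Measurable g) (hf0 : ∀ t, 0 ≤ f t)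
    (hg0 : ∀ t, 0 ≤ g t) (t : ℝ) :
    conv f g t = (lconvolution (fun s => ENNReal.ofReal (f s)) (fun s => ENNReal.ofReal (g s))
      volume t).toReal := by
  rw [conv, convolution, lconvolution_def]
  simp only [ContinuousLinearMap.mul_apply']
  rw [integral_eq_lintegral_of_nonneg_ae
    (Filter.Eventually.of_forall fun s => mul_nonneg (hf0 s) (hg0 _)) (by fun_prop)]
  congr 1
  refine lintegral_congr fun s => ?_
  rw [ENNReal.ofReal_mul (hf0 s), sub_eq_neg_add]

theorem hasLaplace_sum {κ : Type*} (s : Finset κ) {f : κ → ℝ → ℝ} {F : κ → ℂ → ℂ}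
    (h : ∀ l, HasLaplace (f l) (F l)) :
    HasLaplace (fun t => ∑ l ∈ s, f l t) (fun z => ∑ l ∈ s, F l z) := by
  classical
  induction s using Finset.induction_on with
  | empty => exact ⟨by simp, by simp, fun z _ => by simp [laplace]⟩
  | insert a s ha ih =>
    simp_rw [Finset.sum_insert ha]
    exact (h a).add ih

end CausalPart

/-! ### The resolvent `Ψ` as the renewal kernel. -/

section Resolvent

variable {Φ : ℝ → Matrix Component Component ℝ}

/-- The matrix of the positive parts of the kernels in time. -/
noncomputable def kernelMatrix (Φ : ℝ → Matrix Component Component ℝ) (i j : Component) :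
    ℝ → ℝ≥0∞ := causalPart fun t => Φ t i j

/-- The matrix of the masses of the kernels. -/
noncomputable def massMatrix (Φ : ℝ → Matrix Component Component ℝ) :
    Matrix Component Component ℝ := Matrix.of fun i j => ∫ t, Φ t i j

theorem Stable.spectrum_massMatrix (h : Stable Φ) :
    ∀ x ∈ spectrum ℂ ((massMatrix Φ).map Complex.ofReal), ‖x‖ < 1 := by
  have e : (massMatrix Φ).map Complex.ofReal = laplaceMatrix Φ 0 := by
    ext i j
    exact (laplace_zero_right _).symm
  rw [e]
  exact h

variable (hΦ : ∀ i j, IsKernel fun t => Φ t i j)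

include hΦ

theorem massMatrix_nonneg (i j : Component) : 0 ≤ massMatrix Φ i j :=
  integral_nonneg (hΦ i j).nonneg

theorem measurable_kernelMatrix (i j : Component) : Measurable (kernelMatrix Φ i j) :=
  measurable_causalPart (hΦ i j).measurable

theorem lintegral_kernelMatrix (i j : Component) :
    ∫⁻ t, kernelMatrix Φ i j t = ENNReal.ofReal (massMatrix Φ i j) :=
  (hΦ i j).lintegral_causalPart

theorem norm_laplaceMatrix_le {z : ℂ} (hz : z.im ≤ 0) (i j : Component) :
    ‖laplaceMatrix Φ z i j‖ ≤ massMatrix Φ i j := by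
  refine (norm_laplace_le hz (hΦ i j).integrable (hΦ i j).causal).trans_eq ?_
  exact integral_congr_ae (Filter.Eventually.of_forall fun t =>
    Real.norm_of_nonneg ((hΦ i j).nonneg t))

/-- The real form of a solution of the renewal equation with finite integral. -/
theorem toReal_ae_eq_of_renewal_equation {u v : Component → ℝ → ℝ≥0∞}
    (hu : ∀ i, Measurable (u i)) (hfin : ∀ i, ∫⁻ t, u i t ≠ ∞)
    (heq : ∀ i t, u i t = v i t + ∑ l, lconvolution (kernelMatrix Φ i l) (u l) volume t)
    (i : Component) :
    (fun t => (u i t).toReal) =ᵐ[volume] fun t => (v i t).toReal +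
      ∑ l, conv (fun t => Φ t i l) (fun t => (u l t).toReal) t := by
  have hu' : ∀ l, u l =ᵐ[volume] fun t => ENNReal.ofReal (u l t).toReal := fun l => by
    filter_upwards [ae_lt_top (hu l) (hfin l)] with t ht
    rw [ENNReal.ofReal_toReal ht.ne]
  filter_upwards [ae_lt_top (hu i) (hfin i)] with t ht
  have hlt := heq i t ▸ ht
  have hsum := (ENNReal.add_lt_top.1 hlt).2
  rw [heq, ENNReal.toReal_add (ENNReal.add_lt_top.1 hlt).1.ne hsum.ne,
    ENNReal.toReal_sum fun l _ => (ENNReal.sum_lt_top.1 hsum l (Finset.mem_univ l)).ne]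
  refine congrArg _ (Finset.sum_congr rfl fun l _ => ?_)
  rw [conv_eq_toReal_lconvolution (hΦ i l).measurable (hu l).ennreal_toReal (hΦ i l).nonneg
    fun t => ENNReal.toReal_nonneg, kernelMatrix, lconvolution_congr_left (hΦ i l).causalPart_ae_eq,
    lconvolution_congr_right (hu' l)]

variable (hstable : Stable Φ)

include hstable

theorem isUnit_det_one_sub_laplaceMatrix {z : ℂ} (hz : z.im ≤ 0) :
    IsUnit (1 - laplaceMatrix Φ z).det :=
  isUnit_det_one_sub_of_norm_le (massMatrix_nonneg hΦ) hstable.spectrum_massMatrix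
    (norm_laplaceMatrix_le hΦ hz)

theorem lintegral_renewal_kernelMatrix_ne_top (i j : Component) :
    ∫⁻ t, renewal (kernelMatrix Φ) i j t ≠ ∞ :=
  lintegral_renewal_ne_top (measurable_kernelMatrix hΦ) (massMatrix_nonneg hΦ)
    hstable.spectrum_massMatrix (lintegral_kernelMatrix hΦ) i j

theorem ofReal_toReal_renewal (i j : Component) :
    renewal (kernelMatrix Φ) i j =ᵐ[volume]
      fun t => ENNReal.ofReal (renewal (kernelMatrix Φ) i j t).toReal := by
  filter_upwards [ae_lt_top (measurable_renewal (measurable_kernelMatrix hΦ) i j)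
    (lintegral_renewal_kernelMatrix_ne_top hΦ hstable i j)] with t ht
  rw [ENNReal.ofReal_toReal ht.ne]

theorem toReal_renewal_ae_eq (i j : Component) :
    (fun t => (renewal (kernelMatrix Φ) i j t).toReal) =ᵐ[volume] fun t => Φ t i j +
      ∑ l, conv (fun t => Φ t i l) (fun t => (renewal (kernelMatrix Φ) l j t).toReal) t := by
  filter_upwards [toReal_ae_eq_of_renewal_equation hΦ
    (fun i => measurable_renewal (measurable_kernelMatrix hΦ) i j)
    (fun i => lintegral_renewal_kernelMatrix_ne_top hΦ hstable i j)
    (fun i t => renewal_eq (measurable_kernelMatrix hΦ) i j t) i,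
    (hΦ i j).causalPart_ae_eq] with t ht hK
  rw [ht, kernelMatrix, hK, ENNReal.toReal_ofReal ((hΦ i j).nonneg t)]

/-- The transform of `R = Φ + Φ ⋆ R` is `(1 - Φ̂) R̂ = Φ̂`, and `1 - Φ̂` is invertible. -/
theorem isResolvent_renewal :
    IsResolvent Φ fun t => Matrix.of fun i j => (renewal (kernelMatrix Φ) i j t).toReal := by
  have hR := measurable_renewal (measurable_kernelMatrix hΦ)
  set W : ℂ → Matrix Component Component ℂ := fun z =>
    Matrix.of fun i j => laplace (fun t => (renewal (kernelMatrix Φ) i j t).toReal) z with hW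
  have hcausal : ∀ i j, ∀ t < 0, (renewal (kernelMatrix Φ) i j t).toReal = 0 := fun i j t ht => by
    rw [renewal_of_nonpos (K := kernelMatrix Φ) (fun i j t ht => causalPart_of_nonpos ht) i j ht.le, ENNReal.toReal_zero]
  have hL : ∀ i j, HasLaplace (fun t => (renewal (kernelMatrix Φ) i j t).toReal)
      (fun z => W z i j) := fun i j =>
    ⟨integrable_toReal_of_lintegral_ne_top (hR i j).aemeasurable
      (lintegral_renewal_kernelMatrix_ne_top hΦ hstable i j), hcausal i j, fun z _ => rfl⟩
  have hWeq : ∀ z : ℂ, z.im ≤ 0 → W z = laplaceMatrix Φ z + laplaceMatrix Φ z * W z :=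
      fun z hz => by
    ext i j
    have h := ((hΦ i j).hasLaplace.add (hasLaplace_sum Finset.univ fun l =>
      (hΦ i l).hasLaplace.mul (hL l j))).transform z hz
    rw [← laplace_congr (toReal_renewal_ae_eq hΦ hstable i j)] at h
    exact h
  refine fun i j => (hL i j).congr fun z hz => ?_
  have hdet := isUnit_det_one_sub_laplaceMatrix hΦ hstable hz
  set Z := laplaceMatrix Φ z
  have h1 : (1 - Z) * W z = Z := by
    rw [sub_mul, one_mul, sub_eq_iff_eq_add]
    exact hWeq z hz
  have h2 : W z = (1 - Z)⁻¹ * Z := by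
    rw [← congrArg ((1 - Z)⁻¹ * ·) h1, ← Matrix.mul_assoc, Matrix.nonsing_inv_mul _ hdet,
      Matrix.one_mul]
  -- The renewal equation puts the inverse on the left of `Z`, the definition of the resolvent on
  -- the right; they agree because `Z` commutes with `1 - Z`.
  have h3 : Z * (1 - Z) = (1 - Z) * Z := by noncomm_ring
  have h4 : (1 - Z)⁻¹ * Z = Z * (1 - Z)⁻¹ := by
    calc (1 - Z)⁻¹ * Z = (1 - Z)⁻¹ * (Z * ((1 - Z) * (1 - Z)⁻¹)) := by
          rw [Matrix.mul_nonsing_inv _ hdet, Matrix.mul_one]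
      _ = (1 - Z)⁻¹ * ((Z * (1 - Z)) * (1 - Z)⁻¹) := by simp only [Matrix.mul_assoc]
      _ = ((1 - Z)⁻¹ * (1 - Z)) * (Z * (1 - Z)⁻¹) := by rw [h3]; simp only [Matrix.mul_assoc]
      _ = Z * (1 - Z)⁻¹ := by rw [Matrix.nonsing_inv_mul _ hdet, Matrix.one_mul]
  rw [h2, h4]

theorem IsResolvent.ae_eq_renewal {Ψ : ℝ → Matrix Component Component ℝ} (hΨ : IsResolvent Φ Ψ)
    (i j : Component) :
    (fun t => Ψ t i j) =ᵐ[volume] fun t => (renewal (kernelMatrix Φ) i j t).toReal :=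
  (hΨ i j).ae_eq (isResolvent_renewal hΦ hstable i j)

theorem IsResolvent.nonneg {Ψ : ℝ → Matrix Component Component ℝ} (hΨ : IsResolvent Φ Ψ)
    (i j : Component) : ∀ᵐ t, 0 ≤ Ψ t i j := by
  filter_upwards [hΨ.ae_eq_renewal hΦ hstable i j] with t ht
  rw [ht]
  exact ENNReal.toReal_nonneg

theorem IsResolvent.ofReal_ae_eq {Ψ : ℝ → Matrix Component Component ℝ} (hΨ : IsResolvent Φ Ψ)
    (i j : Component) :
    (fun t => ENNReal.ofReal (Ψ t i j)) =ᵐ[volume] renewal (kernelMatrix Φ) i j := by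
  filter_upwards [hΨ.ae_eq_renewal hΦ hstable i j, ofReal_toReal_renewal hΦ hstable i j]
    with t ht ht'
  rw [ht, ← ht']

end Resolvent

/-! ### The mean intensity of the labeled Hawkes process. -/

section MeanIntensity

open ProbabilityTheory (Kernel IsSFiniteKernel IsFiniteKernel)

variable {Θ : ℝ → Matrix Component (Fin 2) ℝ} {α : Fin 2 → Measure ℝ} {μ : ℝ}

theorem exogenous_eq (i : Component) :
    exogenous μ Θ α i = fun t => baseline μ i + ∑ j, mconv (causalPart fun u => Θ u i j) (α j) t :=
  funext fun t => by simp_rw [exogenous, convMeasure_eq_mconv]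

theorem baseline_ne_top (i : Component) : baseline μ i ≠ ∞ := by
  rcases i with i | i <;> simp [baseline]

theorem windowSup_const (c : ℝ≥0∞) : windowSup (volume.withDensity fun _ => c) = c := by
  simp [windowSup]

variable (hΘ : ∀ i j, IsKernel fun t => Θ t i j) [∀ i, IsFiniteMeasure (α i)]

include hΘ

theorem measurable_exogenous (i : Component) : Measurable (exogenous μ Θ α i) := by
  rw [exogenous_eq]
  exact measurable_const.add (Finset.measurable_sum _ fun j _ =>
    measurable_mconv (measurable_causalPart (hΘ i j).measurable))

theorem windowSup_exogenous_ne_top (i : Component) :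
    windowSup (volume.withDensity (exogenous μ Θ α i)) ≠ ∞ := by
  rw [exogenous_eq]
  refine ne_top_of_le_ne_top ?_ (windowSup_add_mconv_le
    (fun j => measurable_causalPart (hΘ i j).measurable) measurable_const)
  rw [windowSup_const]
  refine ENNReal.add_ne_top.2 ⟨baseline_ne_top i, ENNReal.sum_ne_top.2 fun j _ => ?_⟩
  rw [(hΘ i j).lintegral_causalPart]
  exact ENNReal.mul_ne_top ENNReal.ofReal_ne_top
    (ne_top_of_le_ne_top (measure_ne_top _ _) (windowSup_le_univ _))

variable {Ω : Type*} {m : MeasurableSpace Ω} {ℙ : Measure Ω} [IsProbabilityMeasure ℙ]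
  {𝓕 : Filtration ℝ m} {Φ : ℝ → Matrix Component Component ℝ}
  (hΦ : ∀ i j, IsKernel fun t => Φ t i j) (hstable : Stable Φ)
  {P : Component → Ω → Measure ℝ} (hP : IsLabeledHawkes ℙ 𝓕 μ Φ Θ α P)
  {C : ℝ≥0∞} (hC : C < ∞) (hpast : ∀ i, ∀ t ≤ 0, ∫⁻ ω, P i ω (Ioc (t - 1) t) ∂ℙ ≤ C)

include hΦ hstable hP hC hpast

/-- The mean measures of the process have bounded windows and density `E λ`, and `E λ` is the
solution of the renewal equation. -/
theorem mean_intensity_renewal (i : Component) :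
    (∀ t, ∫⁻ ω, intensity μ Φ Θ α P i t ω ∂ℙ = exogenous μ Θ α i t +
      ∑ j, lconvolution (renewal (kernelMatrix Φ) i j) (exogenous μ Θ α j) volume t) ∧
    (∀ B, MeasurableSet B →
      ∫⁻ ω, P i ω B ∂ℙ = ∫⁻ t in B, ∫⁻ ω, intensity μ Φ Θ α P i t ω ∂ℙ) ∧
    Measurable (P i) := by
  have hmeas : ∀ i, Measurable (P i) := fun i => measurable_of_isCounting (hP.counting i)
    fun s t => (hP.adapted i s t).mono (𝓕.le t) le_rfl
  let κ : Component → Kernel Ω ℝ := fun i => ⟨P i, hmeas i⟩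
  have _ : ∀ i, IsSFiniteKernel (κ i) := fun i =>
    isSFiniteKernel_of_isCounting (κ i) (hP.counting i)
  have hK := measurable_kernelMatrix hΦ
  have hG := hstable.spectrum_massMatrix
  have hv := measurable_exogenous (μ := μ) (α := α) hΘ
  have hlam : ∀ i, intensity μ Φ Θ α P i = fun t ω => exogenous μ Θ α i t +
      ∑ j, mconv (kernelMatrix Φ i j) (κ j ω) t := fun i => by
    funext t ω
    simp_rw [intensity, convMeasure_eq_mconv]
    rfl
  have hInt : ∀ i, HasIntensity ℙ 𝓕 (fun ω => κ i ω) (fun t ω => exogenous μ Θ α i t +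
      ∑ j, mconv (kernelMatrix Φ i j) (κ j ω) t) := fun i => by
    rw [← hlam]; exact hP.hasIntensity i
  have hsimple : ∀ i, ∀ᵐ ω ∂ℙ, ∀ t, κ i ω {t} ≤ 1 := fun i => by
    filter_upwards [hP.simple] with ω hω t
    exact (Finset.single_le_sum (f := fun i => P i ω {t}) (fun _ _ => zero_le)
      (Finset.mem_univ i)).trans (hω t)
  have hwin := windowSup_meanOn_univ_ne_top (κ := κ) (massMatrix_nonneg hΦ) hG hK
    (lintegral_kernelMatrix hΦ) (fun i j t ht => causalPart_of_nonpos ht) hv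
    (windowSup_exogenous_ne_top hΘ) hInt hP.counting hP.adapted hsimple hC.ne hpast
  set l : Component → ℝ → ℝ≥0∞ := fun i t => exogenous μ Θ α i t +
    ∑ j, mconv (kernelMatrix Φ i j) (meanOn ℙ (κ j) univ) t with hl
  have hlm : ∀ i, Measurable (l i) := fun i =>
    (hv i).add (Finset.measurable_sum _ fun j _ => measurable_mconv (hK i j))
  have hmean : ∀ i, meanOn ℙ (κ i) univ = volume.withDensity (l i) :=
    meanOn_univ_eq_withDensity hK hv hInt
  have hEl : ∀ i t, ∫⁻ ω, intensity μ Φ Θ α P i t ω ∂ℙ = l i t := fun i t => by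
    rw [hlam]
    exact lintegral_intensity hK i t
  refine ⟨fun t => ?_, fun B hB => ?_, hmeas i⟩
  · rw [hEl]
    -- The mean measure has density `l`, so convolving with it is convolving with `l`: thus `l`
    -- solves the renewal equation, and its windows are bounded by `hwin`.
    refine eq_renewal_solution hK (massMatrix_nonneg hΦ) hG (lintegral_kernelMatrix hΦ) hv
      (windowSup_exogenous_ne_top hΘ) hlm (fun i => hmean i ▸ hwin i) (fun i t => ?_) i t
    simp only [hl]
    refine congrArg _ (Finset.sum_congr rfl fun j _ => ?_)
    rw [hmean j, mconv_withDensity (hK i j) (hlm j)]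
  · simp_rw [hEl]
    rw [← withDensity_apply _ hB, ← hmean, meanOn_univ_apply ℙ (κ i) hB]
    rfl

theorem ae_mean_intensity_lt_top (i : Component) :
    ∀ᵐ t, ∫⁻ ω, intensity μ Φ Θ α P i t ω ∂ℙ < ∞ := by
  simp_rw [(mean_intensity_renewal hΘ hΦ hstable hP hC hpast i).1]
  exact ae_ne_top_of_windowSup (measurable_renewal_solution (measurable_kernelMatrix hΦ)
    (measurable_exogenous hΘ) i) (windowSup_renewal_solution_ne_top (measurable_kernelMatrix hΦ)
    (massMatrix_nonneg hΦ) hstable.spectrum_massMatrix (lintegral_kernelMatrix hΦ)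
    (measurable_exogenous hΘ) (windowSup_exogenous_ne_top hΘ) i)

end MeanIntensity

/-! ### Reduction of the symmetric blocks to a two by two system. -/

section BlockAlgebra

/-- The complex analogue of a matrix with four doubly symmetric blocks. -/
def complexBlocks (ts tc is ic ns nc fs fc : ℂ) : Matrix Component Component ℂ :=
  Matrix.fromBlocks !![ts, tc; tc, ts] !![fs, fc; fc, fs] !![is, ic; ic, is] !![ns, nc; nc, ns]

/-- The imbalance between the two rows of a pair, in the column of index `1` of a pair. -/
def imbalance (W : Matrix Component Component ℂ) (a b : Fin 2 → Component) : ℂ :=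
  W (a 1) (b 1) - W (a 0) (b 1)

variable {ts tc is ic ns nc fs fc : ℂ} {W : Matrix Component Component ℂ}

/-- Subtracting the two rows of a pair turns each doubly symmetric block into the scalar `s - c`.
The imbalances of the inverse thus form the inverse of the reduced `2 × 2` matrix. -/
theorem imbalance_equations (hW : (1 - complexBlocks ts tc is ic ns nc fs fc) * W = 1) :
    (1 - (ts - tc)) * imbalance W Sum.inl Sum.inl - (fs - fc) * imbalance W Sum.inr Sum.inl = 1 ∧
    (1 - (ts - tc)) * imbalance W Sum.inl Sum.inr - (fs - fc) * imbalance W Sum.inr Sum.inr = 0 ∧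
    (1 - (ns - nc)) * imbalance W Sum.inr Sum.inl - (is - ic) * imbalance W Sum.inl Sum.inl = 0 ∧
    (1 - (ns - nc)) * imbalance W Sum.inr Sum.inr - (is - ic) * imbalance W Sum.inl Sum.inr = 1 := by
  have h : ∀ a b : Component, ∑ k, (1 - complexBlocks ts tc is ic ns nc fs fc) a k * W k b =
      (1 : Matrix Component Component ℂ) a b := fun a b =>
    congrFun (congrFun hW a) b
  have h1 := h (Sum.inl 1) (Sum.inl 1)
  have h2 := h (Sum.inl 0) (Sum.inl 1)
  have h3 := h (Sum.inl 1) (Sum.inr 1)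
  have h4 := h (Sum.inl 0) (Sum.inr 1)
  have h5 := h (Sum.inr 1) (Sum.inl 1)
  have h6 := h (Sum.inr 0) (Sum.inl 1)
  have h7 := h (Sum.inr 1) (Sum.inr 1)
  have h8 := h (Sum.inr 0) (Sum.inr 1)
  simp [complexBlocks, Fintype.sum_sum_type, Fin.sum_univ_two, Matrix.one_apply]
    at h1 h2 h3 h4 h5 h6 h7 h8
  simp only [imbalance]
  refine ⟨?_, ?_, ?_, ?_⟩
  · linear_combination h1 - h2
  · linear_combination h3 - h4
  · linear_combination h5 - h6
  · linear_combination h7 - h8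

/-- Multiplicativity of the `2 × 2` determinant. It shows that the denominator is nonzero and
expresses its reciprocal as a polynomial in entries of `W`. -/
theorem denominator_mul_det (hW : (1 - complexBlocks ts tc is ic ns nc fs fc) * W = 1) :
    ((1 - (ts - tc)) * (1 - (ns - nc)) - (is - ic) * (fs - fc)) *
      (imbalance W Sum.inl Sum.inl * imbalance W Sum.inr Sum.inr -
        imbalance W Sum.inl Sum.inr * imbalance W Sum.inr Sum.inl) = 1 := by
  obtain ⟨h1, h2, h3, h4⟩ := imbalance_equations hW
  linear_combination ((1 - (ns - nc)) * imbalance W Sum.inr Sum.inr -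
    (is - ic) * imbalance W Sum.inl Sum.inr) * h1 + h4 -
    ((1 - (ns - nc)) * imbalance W Sum.inr Sum.inl - (is - ic) * imbalance W Sum.inl Sum.inl) * h2

theorem denominator_mul_imbalance (hW : (1 - complexBlocks ts tc is ic ns nc fs fc) * W = 1) :
    ((1 - (ts - tc)) * (1 - (ns - nc)) - (is - ic) * (fs - fc)) *
      imbalance W Sum.inr Sum.inr = 1 - (ts - tc) := by
  obtain ⟨h1, h2, h3, h4⟩ := imbalance_equations hW
  linear_combination (is - ic) * h2 + (1 - (ts - tc)) * h4

end BlockAlgebra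

/-! ### The denominator and the function `Δξ`. -/

section SymmetricKernels

/-- The kernel with the bid-ask symmetry. -/
def blockKernel (Ts Tc Is Ic Ns Nc Fs Fc : ℝ → ℝ) (t : ℝ) : Matrix Component Component ℝ :=
  Matrix.fromBlocks (selfCross (Ts t) (Tc t)) (selfCross (Fs t) (Fc t))
    (selfCross (Is t) (Ic t)) (selfCross (Ns t) (Nc t))

/-- The exogenous kernel with the bid-ask symmetry. -/
def rowKernel (θs θc Is Ic : ℝ → ℝ) (t : ℝ) : Matrix Component (Fin 2) ℝ :=
  Matrix.fromRows (selfCross (θs t) (θc t)) (selfCross (Is t) (Ic t))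

variable {Ts Tc Is Ic Ns Nc Fs Fc θs θc : ℝ → ℝ} {z : ℂ}

theorem laplaceMatrix_blockKernel (z : ℂ) :
    laplaceMatrix (blockKernel Ts Tc Is Ic Ns Nc Fs Fc) z =
      complexBlocks (laplace Ts z) (laplace Tc z) (laplace Is z) (laplace Ic z)
        (laplace Ns z) (laplace Nc z) (laplace Fs z) (laplace Fc z) := by
  ext i j
  rcases i with i | i <;> rcases j with j | j <;> fin_cases i <;> fin_cases j <;> rfl

theorem IsKernel.laplace_sub {f g : ℝ → ℝ} (hf : IsKernel f) (hg : IsKernel g) (hz : z.im ≤ 0) :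
    laplace (f - g) z = laplace f z - laplace g z :=
  HawkesImpact.laplace_sub (integrable_weight_mul hz hf.integrable hf.causal)
    (integrable_weight_mul hz hg.integrable hg.causal)

theorem IsKernel.hasLaplace_sub {f g : ℝ → ℝ} (hf : IsKernel f) (hg : IsKernel g) :
    HasLaplace (f - g) (laplace (f - g)) :=
  ⟨hf.integrable.sub hg.integrable, fun t ht => by
    simp [hf.causal t ht, hg.causal t ht], fun _ _ => rfl⟩

variable (hΦ : ∀ i j, IsKernel fun t => blockKernel Ts Tc Is Ic Ns Nc Fs Fc t i j)

include hΦ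

theorem laplaceMatrix_imbalances (hz : z.im ≤ 0) :
    laplace (Ts - Tc) z = laplace Ts z - laplace Tc z ∧
    laplace (Is - Ic) z = laplace Is z - laplace Ic z ∧
    laplace (Ns - Nc) z = laplace Ns z - laplace Nc z ∧
    laplace (Fs - Fc) z = laplace Fs z - laplace Fc z :=
  ⟨(hΦ (Sum.inl 0) (Sum.inl 0)).laplace_sub (hΦ (Sum.inl 0) (Sum.inl 1)) hz,
    (hΦ (Sum.inr 0) (Sum.inl 0)).laplace_sub (hΦ (Sum.inr 0) (Sum.inl 1)) hz,
    (hΦ (Sum.inr 0) (Sum.inr 0)).laplace_sub (hΦ (Sum.inr 0) (Sum.inr 1)) hz,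
    (hΦ (Sum.inl 0) (Sum.inr 0)).laplace_sub (hΦ (Sum.inl 0) (Sum.inr 1)) hz⟩

variable (hstable : Stable (blockKernel Ts Tc Is Ic Ns Nc Fs Fc))

include hstable

theorem one_sub_mul_inv_blockKernel (hz : z.im ≤ 0) :
    (1 - complexBlocks (laplace Ts z) (laplace Tc z) (laplace Is z) (laplace Ic z)
        (laplace Ns z) (laplace Nc z) (laplace Fs z) (laplace Fc z)) *
      (1 - laplaceMatrix (blockKernel Ts Tc Is Ic Ns Nc Fs Fc) z)⁻¹ = 1 := by
  rw [← laplaceMatrix_blockKernel]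
  exact Matrix.mul_nonsing_inv _ (isUnit_det_one_sub_laplaceMatrix hΦ hstable hz)

theorem impactDenominator_ne_zero (hz : z.im ≤ 0) :
    impactDenominator (Ts - Tc) (Is - Ic) (Ns - Nc) (Fs - Fc) z ≠ 0 := by
  obtain ⟨h1, h2, h3, h4⟩ := laplaceMatrix_imbalances hΦ hz
  rw [impactDenominator, h1, h2, h3, h4]
  exact left_ne_zero_of_mul_eq_one
    (denominator_mul_det (one_sub_mul_inv_blockKernel hΦ hstable hz))

/-- No Wiener type division theorem is needed: by Cramer's rule the quotient is a polynomial in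
`Δθ̂` and the entries of `(1 - Φ̂)⁻¹ = 1 + Ψ̂`, so `Δξ` is built from `Ψ` and `Δθ` by sums and
convolutions. -/
theorem exists_hasLaplace_xiTransform (hθs : IsKernel θs) (hθc : IsKernel θc) :
    ∃ ξ, HasLaplace ξ
      (xiTransform (Ts - Tc) (Is - Ic) (Ns - Nc) (Fs - Fc) (θs - θc)) := by
  obtain ⟨Ψ, hΨ⟩ : ∃ Ψ, IsResolvent (blockKernel Ts Tc Is Ic Ns Nc Fs Fc) Ψ :=
    ⟨_, isResolvent_renewal hΦ hstable⟩
  have hθ := hθs.hasLaplace_sub hθc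
  have hd : ∀ a b : Fin 2 → Component, HasLaplace _ _ := fun a b =>
    (hΨ (a 1) (b 1)).sub (hΨ (a 0) (b 1))
  have hTT := hd Sum.inl Sum.inl
  have hTN := hd Sum.inl Sum.inr
  have hNT := hd Sum.inr Sum.inl
  have hNN := hd Sum.inr Sum.inr
  have h0 : HasLaplace (fun _ => 0) (fun _ => 0) := ⟨by simp, by simp, by simp [laplace]⟩
  -- This is `1 - (1 + NN) - θ ((1 + TT)(1 + NN) - TN · NT)` expanded. The constants cancel, which
  -- is why the result is the transform of a function with no atom at `0`.
  refine ⟨_, ((((((h0.sub hNN).sub hθ).sub (hθ.mul hTT)).sub (hθ.mul hNN)).sub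
    (hθ.mul (hTT.mul hNN))).add (hθ.mul (hTN.mul hNT))).congr fun z hz => ?_⟩
  have hW := one_sub_mul_inv_blockKernel hΦ hstable hz
  have hdet := isUnit_det_one_sub_laplaceMatrix hΦ hstable hz
  have hD := impactDenominator_ne_zero hΦ hstable hz
  have e1 := denominator_mul_det hW
  have e2 := denominator_mul_imbalance hW
  have hres : laplaceMatrix (blockKernel Ts Tc Is Ic Ns Nc Fs Fc) z *
      (1 - laplaceMatrix (blockKernel Ts Tc Is Ic Ns Nc Fs Fc) z)⁻¹ =
      (1 - laplaceMatrix (blockKernel Ts Tc Is Ic Ns Nc Fs Fc) z)⁻¹ - 1 := by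
    have := Matrix.mul_nonsing_inv _ hdet
    rw [sub_mul, one_mul, sub_eq_iff_eq_add] at this
    rw [eq_sub_iff_add_eq, add_comm]
    exact this.symm
  rw [xiTransform]
  obtain ⟨h1, h2, h3, h4⟩ := laplaceMatrix_imbalances hΦ hz
  rw [impactDenominator, h1, h2, h3, h4] at hD ⊢
  rw [eq_sub_iff_add_eq, ← eq_sub_iff_add_eq', div_eq_iff hD, hres]
  simp only [Matrix.sub_apply, Matrix.one_apply_eq, ne_eq, Sum.inl.injEq, Sum.inr.injEq, reduceCtorEq,
    not_false_eq_true, Matrix.one_apply_ne, zero_ne_one, sub_zero]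
  simp only [imbalance] at e1 e2
  linear_combination -e2 - laplace (θs - θc) z * e1

end SymmetricKernels

/-! ### Primitives of convolutions. -/

section Cumulative

variable {f g : ℝ → ℝ} {ν : Measure ℝ}

theorem setIntegral_Iic_convolution [SFinite ν] (hf : Integrable f ν) (hg : Integrable g) (t : ℝ) :
    ∫ x in Iic t, convolution f g (ContinuousLinearMap.mul ℝ ℝ) ν x =
      ∫ s, f s * (∫ y in Iic (t - s), g y) ∂ν := by
  have hint := (hf.convolution_integrand (ContinuousLinearMap.mul ℝ ℝ) hg).mono_measure
    (Measure.prod_mono (Measure.restrict_le_self (s := Iic t)) le_rfl)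
  simp only [convolution]
  rw [integral_integral_swap hint]
  refine integral_congr_ae (Filter.Eventually.of_forall fun s => ?_)
  simp only [ContinuousLinearMap.mul_apply']
  rw [integral_const_mul]
  congr 1
  rw [← integral_indicator measurableSet_Iic, ← integral_indicator measurableSet_Iic,
    ← integral_sub_right_eq_self ((Iic (t - s)).indicator g) s]
  refine integral_congr_ae (Filter.Eventually.of_forall fun x => ?_)
  by_cases hx : x ≤ t
  · simp [indicator, hx]
  · simp [indicator, hx]

theorem integrable_mul_measureReal_Iic [IsFiniteMeasure ν] (hg : Integrable g) (t : ℝ) :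
    Integrable fun u => g u * ν.real (Iic (t - u)) := by
  refine hg.mul_bdd (c := ν.real univ) ?_ ?_
  · have hm : Antitone fun u => ν.real (Iic (t - u)) := fun u u' h =>
      measureReal_mono (Iic_subset_Iic.2 (by linarith))
    exact hm.measurable.aestronglyMeasurable
  · refine Filter.Eventually.of_forall fun u => ?_
    rw [Real.norm_of_nonneg measureReal_nonneg]
    exact measureReal_mono (subset_univ _)

/-- Fubini on the half plane `s + y ≤ t`: the primitive passes from the density `g` to the
distribution function of `ν`. -/
theorem integral_setIntegral_Iic [IsFiniteMeasure ν] (hg : Integrable g) (t : ℝ) :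
    ∫ s, (∫ y in Iic (t - s), g y) ∂ν = ∫ u, g u * ν.real (Iic (t - u)) := by
  have hS : MeasurableSet {p : ℝ × ℝ | p.2 ≤ t - p.1} :=
    measurableSet_le measurable_snd (by fun_prop)
  have hint : Integrable (fun p : ℝ × ℝ => {p : ℝ × ℝ | p.2 ≤ t - p.1}.indicator
      (fun p => g p.2) p) (ν.prod volume) :=
    ((integrable_const (1 : ℝ)).mul_prod hg |>.congr
      (Filter.Eventually.of_forall fun p => one_mul _)).indicator hS
  have e1 : ∀ s, ∫ y in Iic (t - s), g y =
      ∫ y, {p : ℝ × ℝ | p.2 ≤ t - p.1}.indicator (fun p => g p.2) (s, y) := fun s => by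
    rw [← integral_indicator measurableSet_Iic]
    rfl
  simp_rw [e1]
  rw [integral_integral_swap hint]
  refine integral_congr_ae (Filter.Eventually.of_forall fun u => ?_)
  have e2 : ∀ s, {p : ℝ × ℝ | p.2 ≤ t - p.1}.indicator (fun p => g p.2) (s, u) =
      (Iic (t - u)).indicator (fun _ => g u) s := fun s => by
    by_cases h : u ≤ t - s
    · rw [indicator_of_mem (by exact h), indicator_of_mem (mem_Iic.2 (by linarith))]
    · rw [indicator_of_notMem (by exact h),
        indicator_of_notMem (fun h' => h (by linarith [mem_Iic.1 h']))]
  simp only [e2]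
  rw [integral_indicator_const _ measurableSet_Iic, smul_eq_mul, mul_comm]

end Cumulative

/-! ### Splitting the mean intensity into baseline and response to the agent. -/

section AgentResponse

variable {f : ℝ → ℝ} {ν : Measure ℝ}

theorem integrable_one_convolution [IsFiniteMeasure ν] (hf : Integrable f) :
    Integrable (convolution (fun _ => 1) f (ContinuousLinearMap.mul ℝ ℝ) ν) :=
  ((integrable_const (1 : ℝ)).convolution_integrand (ContinuousLinearMap.mul ℝ ℝ)
    hf).integral_prod_left

/-- The transform of a finite measure on the real axis. -/
noncomputable def measureTransform (ν : Measure ℝ) (x : ℝ) : ℂ :=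
  ∫ t : ℝ, Complex.exp (-(Complex.I * (x : ℂ) * (t : ℂ))) * ((1 : ℝ) : ℂ) ∂ν

theorem laplace_one_convolution [IsFiniteMeasure ν] (hf : Integrable f) (x : ℝ) :
    laplace (convolution (fun _ => 1) f (ContinuousLinearMap.mul ℝ ℝ) ν) x =
      measureTransform ν x * laplace f x :=
  laplace_convolution (integrable_weight_mul_of_real x (integrable_const (1 : ℝ)))
    (integrable_weight_mul_of_real x hf)

theorem causalPart_lt_top (t : ℝ) : causalPart f t < ∞ := by
  rw [causalPart, indicator]
  split_ifs <;> simp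

theorem toReal_mconv_causalPart (hf : Measurable f) (t : ℝ) :
    (mconv (causalPart f) ν t).toReal =
      convolution (fun _ => 1) (fun s => (causalPart f s).toReal) (ContinuousLinearMap.mul ℝ ℝ)
        ν t := by
  have hm : Measurable fun s => causalPart f (t - s) :=
    (measurable_causalPart hf).comp (measurable_const.sub measurable_id)
  simp only [convolution, ContinuousLinearMap.mul_apply', one_mul]
  rw [integral_toReal hm.aemeasurable (Filter.Eventually.of_forall fun s => causalPart_lt_top _)]
  rfl

theorem IsKernel.toReal_causalPart_ae_eq (hf : IsKernel f) :
    (fun t => (causalPart f t).toReal) =ᵐ[volume] f := by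
  filter_upwards [hf.causalPart_ae_eq] with t ht
  rw [ht, ENNReal.toReal_ofReal (hf.nonneg t)]

theorem IsKernel.lintegral_mconv_ne_top [IsFiniteMeasure ν] (hf : IsKernel f) :
    ∫⁻ t, mconv (causalPart f) ν t ≠ ∞ := by
  rw [lintegral_mconv (measurable_causalPart hf.measurable), hf.lintegral_causalPart]
  finiteness

theorem IsKernel.integrable_toReal_mconv [IsFiniteMeasure ν] (hf : IsKernel f) :
    Integrable fun t => (mconv (causalPart f) ν t).toReal :=
  integrable_toReal_of_lintegral_ne_top
    (measurable_mconv (measurable_causalPart hf.measurable)).aemeasurable hf.lintegral_mconv_ne_top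

theorem IsKernel.laplace_toReal_mconv [IsFiniteMeasure ν] (hf : IsKernel f) (x : ℝ) :
    laplace (fun t => (mconv (causalPart f) ν t).toReal) x =
      measureTransform ν x * laplace f x := by
  simp_rw [toReal_mconv_causalPart hf.measurable]
  rw [← laplace_congr hf.toReal_causalPart_ae_eq]
  exact laplace_one_convolution (hf.integrable.congr hf.toReal_causalPart_ae_eq.symm) x

theorem mconv_causalPart_of_nonpos (hν : ∀ᵐ s ∂ν, 0 ≤ s) {t : ℝ} (ht : t ≤ 0) :
    mconv (causalPart f) ν t = 0 := by
  refine lintegral_eq_zero_of_ae_eq_zero ?_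
  filter_upwards [hν] with s hs
  exact causalPart_of_nonpos (by linarith)

/-- The intensity that the agent triggers directly. -/
noncomputable def agentForcing (Θ : ℝ → Matrix Component (Fin 2) ℝ) (α : Fin 2 → Measure ℝ)
    (i : Component) (t : ℝ) : ℝ≥0∞ := ∑ j, mconv (causalPart fun u => Θ u i j) (α j) t

/-- The mean intensity that the agent triggers directly or through the process. -/
noncomputable def agentResponse (Φ : ℝ → Matrix Component Component ℝ)
    (Θ : ℝ → Matrix Component (Fin 2) ℝ) (α : Fin 2 → Measure ℝ) (i : Component) (t : ℝ) : ℝ≥0∞ :=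
  agentForcing Θ α i t +
    ∑ j, lconvolution (renewal (kernelMatrix Φ) i j) (agentForcing Θ α j) volume t

/-- The mean intensity of the process without agent. -/
noncomputable def meanBaseline (μ : ℝ) (Φ : ℝ → Matrix Component Component ℝ) (i : Component)
    (t : ℝ) : ℝ≥0∞ :=
  baseline μ i + ∑ j, lconvolution (renewal (kernelMatrix Φ) i j) (fun _ => baseline μ j) volume t

variable {Φ : ℝ → Matrix Component Component ℝ} {Θ : ℝ → Matrix Component (Fin 2) ℝ}
  {α : Fin 2 → Measure ℝ} {μ : ℝ}

theorem agentForcing_of_nonpos (hα : ∀ j, ∀ᵐ s ∂α j, 0 ≤ s) (i : Component) {t : ℝ} (ht : t ≤ 0) :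
    agentForcing Θ α i t = 0 :=
  Finset.sum_eq_zero fun j _ => mconv_causalPart_of_nonpos (hα j) ht

theorem agentResponse_of_nonpos (hα : ∀ j, ∀ᵐ s ∂α j, 0 ≤ s) (i : Component) {t : ℝ} (ht : t ≤ 0) :
    agentResponse Φ Θ α i t = 0 := by
  rw [agentResponse, agentForcing_of_nonpos hα i ht, zero_add]
  exact Finset.sum_eq_zero fun j _ => lconvolution_eq_zero_of_nonpos
    (fun t ht => renewal_of_nonpos (fun i j t ht => causalPart_of_nonpos ht) i j ht)
    (fun t ht => agentForcing_of_nonpos hα j ht) ht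

/-- The two parts need different tools: the baseline part is not integrable in general but inherits
the symmetry, while the response is integrable and can be transformed. -/
theorem exogenous_solution_eq_add (hΦ : ∀ i j, IsKernel fun t => Φ t i j) (i : Component) (t : ℝ) :
    exogenous μ Θ α i t +
      ∑ j, lconvolution (renewal (kernelMatrix Φ) i j) (exogenous μ Θ α j) volume t =
      meanBaseline μ Φ i t + agentResponse Φ Θ α i t := by
  have e : ∀ j, exogenous μ Θ α j = fun t => baseline μ j + agentForcing Θ α j t := fun j =>
    exogenous_eq j
  simp_rw [e, lconvolution_add_right (measurable_renewal (measurable_kernelMatrix hΦ) i _)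
    measurable_const, Finset.sum_add_distrib, meanBaseline, agentResponse]
  abel

variable (hΘ : ∀ i j, IsKernel fun t => Θ t i j) [∀ i, IsFiniteMeasure (α i)]

section

include hΘ

theorem measurable_agentForcing (i : Component) : Measurable (agentForcing Θ α i) :=
  Finset.measurable_sum _ fun j _ => measurable_mconv (measurable_causalPart (hΘ i j).measurable)

theorem lintegral_agentForcing_ne_top (i : Component) : ∫⁻ t, agentForcing Θ α i t ≠ ∞ := by
  simp only [agentForcing]
  rw [lintegral_finsetSum _ fun j _ => measurable_mconv (measurable_causalPart (hΘ i j).measurable)]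
  exact ENNReal.sum_ne_top.2 fun j _ => (hΘ i j).lintegral_mconv_ne_top

theorem toReal_agentForcing_ae_eq (i : Component) :
    (fun t => (agentForcing Θ α i t).toReal) =ᵐ[volume] fun t =>
      (mconv (causalPart fun u => Θ u i 0) (α 0) t).toReal +
        (mconv (causalPart fun u => Θ u i 1) (α 1) t).toReal := by
  filter_upwards [ae_lt_top (measurable_agentForcing (α := α) hΘ i)
    (lintegral_agentForcing_ne_top hΘ i)] with t ht
  rw [agentForcing, Fin.sum_univ_two] at ht ⊢
  rw [ENNReal.toReal_add (ENNReal.add_lt_top.1 ht).1.ne (ENNReal.add_lt_top.1 ht).2.ne]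

theorem laplace_toReal_agentForcing (i : Component) (x : ℝ) :
    laplace (fun t => (agentForcing Θ α i t).toReal) x =
      measureTransform (α 0) x * laplace (fun t => Θ t i 0) x +
        measureTransform (α 1) x * laplace (fun t => Θ t i 1) x := by
  rw [laplace_congr (toReal_agentForcing_ae_eq hΘ i), laplace_add
    (integrable_weight_mul_of_real x (hΘ i 0).integrable_toReal_mconv)
    (integrable_weight_mul_of_real x (hΘ i 1).integrable_toReal_mconv),
    (hΘ i 0).laplace_toReal_mconv, (hΘ i 1).laplace_toReal_mconv]

end

variable (hΦ : ∀ i j, IsKernel fun t => Φ t i j) (hstable : Stable Φ)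

section

include hΦ

theorem measurable_meanBaseline (i : Component) : Measurable (meanBaseline μ Φ i) :=
  measurable_renewal_solution (measurable_kernelMatrix hΦ) (fun _ => measurable_const) i

include hstable

theorem windowSup_meanBaseline_ne_top (i : Component) :
    windowSup (volume.withDensity (meanBaseline μ Φ i)) ≠ ∞ :=
  windowSup_renewal_solution_ne_top (measurable_kernelMatrix hΦ) (massMatrix_nonneg hΦ)
    hstable.spectrum_massMatrix (lintegral_kernelMatrix hΦ) (fun _ => measurable_const)
    (fun i => by rw [windowSup_const]; exact baseline_ne_top i) i

/-- A symmetry of the kernels and of the baseline is a symmetry of the mean intensity. -/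
theorem meanBaseline_symm (σ : Equiv.Perm Component)
    (hσ : ∀ i j, kernelMatrix Φ (σ i) (σ j) = kernelMatrix Φ i j)
    (hσ' : ∀ i, baseline μ (σ i) = baseline μ i) (i : Component) :
    meanBaseline μ Φ (σ i) = meanBaseline μ Φ i := by
  have h := renewal_solution (measurable_kernelMatrix hΦ) (v := fun i _ => baseline μ i)
    fun _ => measurable_const
  refine congrFun (eq_of_renewal_equation (v := fun i _ => baseline μ i)
    (u := fun i => meanBaseline μ Φ (σ i))
    (measurable_kernelMatrix hΦ) (massMatrix_nonneg hΦ)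
    hstable.spectrum_massMatrix (lintegral_kernelMatrix hΦ)
    (fun i => measurable_meanBaseline hΦ _) (fun i => measurable_meanBaseline hΦ _)
    (fun i => windowSup_meanBaseline_ne_top hΦ hstable _)
    (fun i => windowSup_meanBaseline_ne_top hΦ hstable _) (fun i t => ?_) h) i
  refine (h (σ i) t).trans ?_
  -- Reindexing the sum by `σ` shows that the permuted solution solves the same equation, so
  -- uniqueness applies.
  rw [hσ', ← Equiv.sum_comp σ]
  simp_rw [hσ]
  rfl

end

include hΘ hΦ

theorem measurable_agentResponse (i : Component) : Measurable (agentResponse Φ Θ α i) :=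
  measurable_renewal_solution (measurable_kernelMatrix hΦ) (measurable_agentForcing hΘ) i

include hstable

theorem lintegral_agentResponse_ne_top (i : Component) : ∫⁻ t, agentResponse Φ Θ α i t ≠ ∞ := by
  have hR := measurable_renewal (measurable_kernelMatrix hΦ)
  simp only [agentResponse]
  rw [lintegral_add_left (measurable_agentForcing hΘ i), lintegral_finsetSum _ fun j _ =>
    measurable_lconvolution _ (hR i j) (measurable_agentForcing hΘ j)]
  refine ENNReal.add_ne_top.2 ⟨lintegral_agentForcing_ne_top hΘ i, ENNReal.sum_ne_top.2
    fun j _ => ?_⟩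
  rw [lintegral_lconvolution (hR i j) (measurable_agentForcing hΘ j)]
  exact ENNReal.mul_ne_top (lintegral_renewal_kernelMatrix_ne_top hΦ hstable i j)
    (lintegral_agentForcing_ne_top hΘ j)

theorem integrable_toReal_agentResponse (i : Component) :
    Integrable fun t => (agentResponse Φ Θ α i t).toReal :=
  integrable_toReal_of_lintegral_ne_top (measurable_agentResponse hΘ hΦ i).aemeasurable
    (lintegral_agentResponse_ne_top hΘ hΦ hstable i)

theorem laplace_toReal_agentResponse (hα : ∀ j, ∀ᵐ s ∂α j, 0 ≤ s) (i : Component) (x : ℝ) :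
    laplace (fun t => (agentResponse Φ Θ α i t).toReal) x =
      laplace (fun t => (agentForcing Θ α i t).toReal) x +
        ∑ l, laplaceMatrix Φ x i l * laplace (fun t => (agentResponse Φ Θ α l t).toReal) x := by
  have h1 : HasLaplace (fun t => (agentForcing Θ α i t).toReal) (laplace _) :=
    ⟨integrable_toReal_of_lintegral_ne_top (measurable_agentForcing hΘ i).aemeasurable
      (lintegral_agentForcing_ne_top hΘ i),
      fun t ht => by rw [agentForcing_of_nonpos hα i ht.le, ENNReal.toReal_zero], fun _ _ => rfl⟩
  have h2 : ∀ l, HasLaplace (fun t => (agentResponse Φ Θ α l t).toReal) (laplace _) := fun l =>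
    ⟨integrable_toReal_agentResponse hΘ hΦ hstable l,
      fun t ht => by rw [agentResponse_of_nonpos hα l ht.le, ENNReal.toReal_zero], fun _ _ => rfl⟩
  have h := (h1.add (hasLaplace_sum Finset.univ fun l => (hΦ i l).hasLaplace.mul (h2 l))).transform
    x (by simp)
  rw [← laplace_congr (toReal_ae_eq_of_renewal_equation hΦ (measurable_agentResponse hΘ hΦ)
    (lintegral_agentResponse_ne_top hΘ hΦ hstable) (renewal_solution (measurable_kernelMatrix hΦ)
    (measurable_agentForcing hΘ)) i)] at h
  exact h

end AgentResponse

/-! ### The price imbalance and the impact profile. -/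

section MarketImpact

variable {Ts Tc Is Ic Ns Nc Fs Fc θs θc : ℝ → ℝ} {α : Fin 2 → Measure ℝ}
  [∀ i, IsFiniteMeasure (α i)] {μ : ℝ}

/-- The difference of the mean intensities of up and down jumps of the price. -/
noncomputable def responseImbalance (Φ : ℝ → Matrix Component Component ℝ)
    (Θ : ℝ → Matrix Component (Fin 2) ℝ) (α : Fin 2 → Measure ℝ) (a : Fin 2 → Component)
    (t : ℝ) : ℝ :=
  (agentResponse Φ Θ α (a 1) t).toReal - (agentResponse Φ Θ α (a 0) t).toReal

/-- The convolution of `f` with the signed measure `dA⁺ - dA⁻`. -/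
noncomputable def agentConv (f : ℝ → ℝ) (α : Fin 2 → Measure ℝ) (t : ℝ) : ℝ :=
  convolution (fun _ => 1) f (ContinuousLinearMap.mul ℝ ℝ) (α 1) t -
    convolution (fun _ => 1) f (ContinuousLinearMap.mul ℝ ℝ) (α 0) t

theorem integrable_agentConv {f : ℝ → ℝ} (hf : Integrable f) : Integrable (agentConv f α) :=
  (integrable_one_convolution hf).sub (integrable_one_convolution hf)

theorem laplace_agentConv {f : ℝ → ℝ} (hf : Integrable f) (x : ℝ) :
    laplace (agentConv f α) x =
      (measureTransform (α 1) x - measureTransform (α 0) x) * laplace f x := by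
  unfold agentConv
  rw [laplace_sub (integrable_weight_mul_of_real x (integrable_one_convolution hf))
    (integrable_weight_mul_of_real x (integrable_one_convolution hf)),
    laplace_one_convolution hf, laplace_one_convolution hf, sub_mul]

theorem setIntegral_Iic_agentConv {f : ℝ → ℝ} (hf : Integrable f) (t : ℝ) :
    ∫ x in Iic t, agentConv f α x = conv f (agentImbalance α) t := by
  simp only [agentConv]
  rw [integral_sub (integrable_one_convolution hf).integrableOn
    (integrable_one_convolution hf).integrableOn,
    setIntegral_Iic_convolution (integrable_const _) hf,
    setIntegral_Iic_convolution (integrable_const _) hf]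
  simp only [one_mul]
  rw [integral_setIntegral_Iic hf, integral_setIntegral_Iic hf,
    ← integral_sub (integrable_mul_measureReal_Iic hf t) (integrable_mul_measureReal_Iic hf t)]
  refine integral_congr_ae (Filter.Eventually.of_forall fun u => ?_)
  simp only [agentImbalance, ContinuousLinearMap.mul_apply', mul_sub]

variable (hΦ : ∀ i j, IsKernel fun t => blockKernel Ts Tc Is Ic Ns Nc Fs Fc t i j)
  (hΘ : ∀ i j, IsKernel fun t => rowKernel θs θc Is Ic t i j)
  (hstable : Stable (blockKernel Ts Tc Is Ic Ns Nc Fs Fc))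

include hΦ hstable

theorem meanBaseline_price_eq :
    meanBaseline μ (blockKernel Ts Tc Is Ic Ns Nc Fs Fc) (Sum.inr 1) =
      meanBaseline μ (blockKernel Ts Tc Is Ic Ns Nc Fs Fc) (Sum.inr 0) := by
  refine meanBaseline_symm hΦ hstable (Equiv.sumCongr (Equiv.swap 0 1) (Equiv.swap 0 1))
    (fun i j => ?_) (fun i => ?_) (Sum.inr 0)
  · rcases i with i | i <;> rcases j with j | j <;> fin_cases i <;> fin_cases j <;> rfl
  · rcases i with i | i <;> rfl

include hΘ

theorem integrable_responseImbalance (a : Fin 2 → Component) :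
    Integrable (responseImbalance (blockKernel Ts Tc Is Ic Ns Nc Fs Fc)
      (rowKernel θs θc Is Ic) α a) :=
  (integrable_toReal_agentResponse hΘ hΦ hstable _).sub
    (integrable_toReal_agentResponse hΘ hΦ hstable _)

/-- With `a = Â⁺ - Â⁻`, row differences give `(1 - ΔT) τ = Δθ a + ΔF η` and `(1 - ΔN) η = ΔI (a +
τ)` for the imbalances `τ`, `η` of trades and price jumps. Eliminating `τ` leaves the denominator
times `η` equal to `ΔI (1 - ΔT + Δθ) a`; the factorization uses that the agent acts on prices
through the same block as all other trades. -/
theorem laplace_responseImbalance (hα : ∀ j, ∀ᵐ s ∂α j, 0 ≤ s) (x : ℝ) :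
    laplace (responseImbalance (blockKernel Ts Tc Is Ic Ns Nc Fs Fc)
      (rowKernel θs θc Is Ic) α Sum.inr) x =
      (1 - xiTransform (Ts - Tc) (Is - Ic) (Ns - Nc) (Fs - Fc) (θs - θc) x) *
        ((measureTransform (α 1) x - measureTransform (α 0) x) * laplace (Is - Ic) x) := by
  have hx : (x : ℂ).im ≤ 0 := by simp
  have hsub : ∀ a : Fin 2 → Component, laplace (responseImbalance
      (blockKernel Ts Tc Is Ic Ns Nc Fs Fc) (rowKernel θs θc Is Ic) α a) x = _ := fun a =>
    laplace_sub
      (integrable_weight_mul_of_real x (integrable_toReal_agentResponse hΘ hΦ hstable (a 1)))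
      (integrable_weight_mul_of_real x (integrable_toReal_agentResponse hΘ hΦ hstable (a 0)))
  have hres : ∀ i, _ := fun i => laplace_toReal_agentResponse hΘ hΦ hstable hα i x
  have h1 := hres (Sum.inl 1)
  have h2 := hres (Sum.inl 0)
  have h3 := hres (Sum.inr 1)
  have h4 := hres (Sum.inr 0)
  rw [laplace_toReal_agentForcing hΘ, laplaceMatrix_blockKernel] at h1 h2 h3 h4
  have hrow : (fun t => rowKernel θs θc Is Ic t (Sum.inl 1) 0) = θc ∧
      (fun t => rowKernel θs θc Is Ic t (Sum.inl 1) 1) = θs ∧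
      (fun t => rowKernel θs θc Is Ic t (Sum.inl 0) 0) = θs ∧
      (fun t => rowKernel θs θc Is Ic t (Sum.inl 0) 1) = θc ∧
      (fun t => rowKernel θs θc Is Ic t (Sum.inr 1) 0) = Ic ∧
      (fun t => rowKernel θs θc Is Ic t (Sum.inr 1) 1) = Is ∧
      (fun t => rowKernel θs θc Is Ic t (Sum.inr 0) 0) = Is ∧
      (fun t => rowKernel θs θc Is Ic t (Sum.inr 0) 1) = Ic :=
    ⟨rfl, rfl, rfl, rfl, rfl, rfl, rfl, rfl⟩
  obtain ⟨r1, r2, r3, r4, r5, r6, r7, r8⟩ := hrow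
  rw [r1, r2] at h1
  rw [r3, r4] at h2
  rw [r5, r6] at h3
  rw [r7, r8] at h4
  simp only [complexBlocks, Fintype.sum_sum_type, Fin.sum_univ_two, Matrix.fromBlocks_apply₁₁,
    Matrix.fromBlocks_apply₁₂, Matrix.fromBlocks_apply₂₁, Matrix.fromBlocks_apply₂₂,
    Matrix.of_apply, Matrix.cons_val_zero, Matrix.cons_val_one, Matrix.cons_val_fin_one]
    at h1 h2 h3 h4
  have hD := impactDenominator_ne_zero hΦ hstable hx
  obtain ⟨e1, e2, e3, e4⟩ := laplaceMatrix_imbalances hΦ hx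
  have e5 : laplace (θs - θc) x = laplace θs x - laplace θc x :=
    (hΘ (Sum.inl 0) 0).laplace_sub (hΘ (Sum.inl 0) 1) hx
  rw [hsub, xiTransform, sub_sub_cancel, div_mul_eq_mul_div, eq_div_iff hD, impactDenominator,
    e1, e2, e3, e4, e5]
  linear_combination (laplace Is x - laplace Ic x) * (h1 - h2) +
    (1 - (laplace Ts x - laplace Tc x)) * (h3 - h4)

theorem responseImbalance_ae_eq (hα : ∀ j, ∀ᵐ s ∂α j, 0 ≤ s) {ξ : ℝ → ℝ}
    (hξ : HasLaplace ξ (xiTransform (Ts - Tc) (Is - Ic) (Ns - Nc) (Fs - Fc) (θs - θc))) :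
    responseImbalance (blockKernel Ts Tc Is Ic Ns Nc Fs Fc) (rowKernel θs θc Is Ic) α Sum.inr
      =ᵐ[volume] fun t => agentConv (Is - Ic) α t - conv ξ (agentConv (Is - Ic) α) t := by
  have hI : Integrable (Is - Ic) :=
    ((hΦ (Sum.inr 0) (Sum.inl 0)).hasLaplace_sub (hΦ (Sum.inr 0) (Sum.inl 1))).integrable
  have hq := integrable_agentConv (α := α) hI
  refine ae_eq_of_laplace_eq (integrable_responseImbalance hΦ hΘ hstable _)
    (hq.sub (integrable_conv hξ.integrable hq)) fun x => ?_
  rw [laplace_responseImbalance hΦ hΘ hstable hα, laplace_sub (integrable_weight_mul_of_real x hq)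
    (integrable_weight_mul_of_real x (integrable_conv hξ.integrable hq)),
    laplace_conv_of_real x hξ.integrable hq, hξ.transform x (by simp), laplace_agentConv hI]
  ring

theorem setIntegral_responseImbalance (hα : ∀ j, ∀ᵐ s ∂α j, 0 ≤ s) {ξ : ℝ → ℝ}
    (hξ : HasLaplace ξ (xiTransform (Ts - Tc) (Is - Ic) (Ns - Nc) (Fs - Fc) (θs - θc)))
    (t : ℝ) :
    ∫ x in Ioc 0 t, responseImbalance (blockKernel Ts Tc Is Ic Ns Nc Fs Fc)
      (rowKernel θs θc Is Ic) α Sum.inr x =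
      conv (Is - Ic) (agentImbalance α) t - conv ξ (conv (Is - Ic) (agentImbalance α)) t := by
  have hI : Integrable (Is - Ic) :=
    ((hΦ (Sum.inr 0) (Sum.inl 0)).hasLaplace_sub (hΦ (Sum.inr 0) (Sum.inl 1))).integrable
  have hq := integrable_agentConv (α := α) hI
  have e1 : ∫ x in Ioc 0 t, responseImbalance (blockKernel Ts Tc Is Ic Ns Nc Fs Fc)
      (rowKernel θs θc Is Ic) α Sum.inr x = ∫ x in Iic t, responseImbalance
        (blockKernel Ts Tc Is Ic Ns Nc Fs Fc) (rowKernel θs θc Is Ic) α Sum.inr x := by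
    -- The agent acts from time `0` on and the kernels act at strictly positive lags, so the
    -- response vanishes up to and including time `0`.
    refine (setIntegral_eq_of_subset_of_forall_sdiff_eq_zero measurableSet_Iic
      (fun x hx => hx.2) fun x hx => ?_).symm
    have hx0 : x ≤ 0 := not_lt.1 fun h => hx.2 ⟨h, hx.1⟩
    rw [responseImbalance, agentResponse_of_nonpos hα _ hx0, agentResponse_of_nonpos hα _ hx0,
      sub_self]
  rw [e1, integral_congr_ae (ae_restrict_of_ae (responseImbalance_ae_eq hΦ hΘ hstable hα hξ)),
    integral_sub hq.integrableOn (integrable_conv hξ.integrable hq).integrableOn,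
    setIntegral_Iic_agentConv hI]
  refine congrArg _ ((setIntegral_Iic_convolution hξ.integrable hq t).trans ?_)
  simp_rw [setIntegral_Iic_agentConv hI]
  rfl

variable {Ω : Type*} {m : MeasurableSpace Ω} {ℙ : Measure Ω} [IsProbabilityMeasure ℙ]
  {𝓕 : Filtration ℝ m} {P : Component → Ω → Measure ℝ}
  (hP : IsLabeledHawkes ℙ 𝓕 μ (blockKernel Ts Tc Is Ic Ns Nc Fs Fc) (rowKernel θs θc Is Ic) α P)
  {C : ℝ≥0∞} (hC : C < ∞) (hpast : ∀ i, ∀ t ≤ 0, ∫⁻ ω, P i ω (Ioc (t - 1) t) ∂ℙ ≤ C)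

include hP hC hpast

/-- The mean of the price is the integral of the imbalance of the mean intensities. -/
theorem integral_price (t : ℝ) :
    Integrable (price P t) ℙ ∧ ∫ ω, price P t ω ∂ℙ =
      ∫ x in Ioc 0 t, responseImbalance (blockKernel Ts Tc Is Ic Ns Nc Fs Fc)
        (rowKernel θs θc Is Ic) α Sum.inr x := by
  set Φ := blockKernel Ts Tc Is Ic Ns Nc Fs Fc
  set Θ := rowKernel θs θc Is Ic
  have hresp : ∀ i, ∫⁻ x in Ioc 0 t, agentResponse Φ Θ α i x ≠ ∞ := fun i =>
    ne_top_of_le_ne_top (lintegral_agentResponse_ne_top hΘ hΦ hstable i)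
      (setLIntegral_le_lintegral _ _)
  have hbase : ∀ i, ∫⁻ x in Ioc 0 t, meanBaseline μ Φ i x ≠ ∞ := fun i => by
    rw [← withDensity_apply _ measurableSet_Ioc]
    exact (measure_Ioc_lt_top (windowSup_meanBaseline_ne_top hΦ hstable i) 0 t).ne
  have hmean : ∀ i, ∫⁻ ω, P i ω (Ioc 0 t) ∂ℙ = (∫⁻ x in Ioc 0 t, meanBaseline μ Φ i x) +
      ∫⁻ x in Ioc 0 t, agentResponse Φ Θ α i x := fun i => by
    obtain ⟨h1, h2, -⟩ := mean_intensity_renewal hΘ hΦ hstable hP hC hpast i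
    rw [h2 _ measurableSet_Ioc, ← lintegral_add_left (measurable_meanBaseline hΦ i)]
    exact lintegral_congr fun x => (h1 x).trans (exogenous_solution_eq_add hΦ i x)
  have hfin : ∀ i, ∫⁻ ω, P i ω (Ioc 0 t) ∂ℙ ≠ ∞ := fun i => by
    rw [hmean]
    exact ENNReal.add_ne_top.2 ⟨hbase i, hresp i⟩
  have hmeas : ∀ i, Measurable fun ω => P i ω (Ioc 0 t) := fun i =>
    (Measure.measurable_coe measurableSet_Ioc).comp
      (mean_intensity_renewal hΘ hΦ hstable hP hC hpast i).2.2
  have hint : ∀ i, Integrable (fun ω => (P i ω).real (Ioc 0 t)) ℙ := fun i =>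
    integrable_toReal_of_lintegral_ne_top (hmeas i).aemeasurable (hfin i)
  have hval : ∀ i, ∫ ω, (P i ω).real (Ioc 0 t) ∂ℙ =
      (∫⁻ x in Ioc 0 t, meanBaseline μ Φ i x).toReal +
        ∫ x in Ioc 0 t, (agentResponse Φ Θ α i x).toReal := fun i => by
    have e := integral_toReal (hmeas i).aemeasurable (ae_lt_top (hmeas i) (hfin i))
    rw [hmean, ENNReal.toReal_add (hbase i) (hresp i)] at e
    rw [integral_toReal (measurable_agentResponse hΘ hΦ i).aemeasurable
      (ae_lt_top (measurable_agentResponse hΘ hΦ i) (hresp i))]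
    exact e
  refine ⟨(hint _).sub (hint _), ?_⟩
  simp only [price]
  -- The baseline contributions to up and down jumps are finite on `(0, t]` and equal, so they
  -- cancel.
  rw [integral_sub (hint _) (hint _), hval, hval, meanBaseline_price_eq hΦ hstable,
    add_sub_add_left_eq_sub]
  exact (integral_sub (integrable_toReal_agentResponse hΘ hΦ hstable _).integrableOn
    (integrable_toReal_agentResponse hΘ hΦ hstable _).integrableOn).symm

end MarketImpact

end HawkesImpact

open HawkesImpact in
theorem mainTheorem5 {Ω : Type*} {m : MeasurableSpace Ω} (ℙ : Measure Ω) [IsProbabilityMeasure ℙ]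
    (𝓕 : Filtration ℝ m)
    -- the parameters of the model, with the stability condition
    (μ : ℝ) (hμ : 0 ≤ μ)
    (Φ : ℝ → Matrix Component Component ℝ) (hΦ : ∀ i j, IsKernel fun t => Φ t i j)
    (hstable : Stable Φ)
    (Θ : ℝ → Matrix Component (Fin 2) ℝ) (hΘ : ∀ i j, IsKernel fun t => Θ t i j)
    -- the labeled agent, active on `[0, T)` only
    (α : Fin 2 → Measure ℝ) [∀ i, IsFiniteMeasure (α i)]
    (T : ℝ) (hT : 0 < T) (hα : ∀ i, α i (Ico 0 T)ᶜ = 0)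
    -- the point process
    (P : Component → Ω → Measure ℝ) (hP : IsLabeledHawkes ℙ 𝓕 μ Φ Θ α P)
    -- before the agent acts, the mean number of points per unit of time is bounded (as it is
    -- when `P` has stationary increments with finite mean there)
    (C : ℝ≥0∞) (hC : C < ∞) (hpast : ∀ i, ∀ t ≤ 0, ∫⁻ ω, P i ω (Ioc (t - 1) t) ∂ℙ ≤ C) :
    -- `Ψ` is well defined by its transform
    (∀ z : ℂ, z.im ≤ 0 → IsUnit (1 - laplaceMatrix Φ z).det) ∧
    (∃ Ψ, IsResolvent Φ Ψ) ∧
    -- `E λ = (δ I + Ψ) ⋆ (M + Θ ⋆ dA)`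
    (∀ Ψ, IsResolvent Φ Ψ →
      (∀ i j, ∀ᵐ t, 0 ≤ Ψ t i j) ∧
      (∀ i t, ∫⁻ ω, intensity μ Φ Θ α P i t ω ∂ℙ =
        exogenous μ Θ α i t +
          ∑ j, lconvolution (fun s => ENNReal.ofReal (Ψ s i j)) (exogenous μ Θ α j) volume t)) ∧
    (∀ i, ∀ᵐ t, ∫⁻ ω, intensity μ Φ Θ α P i t ω ∂ℙ < ∞) ∧
    -- the market impact, for kernels with the bid-ask symmetry and `Θᴵ = Φᴵ`
    (∀ Ts Tc Is Ic Ns Nc Fs Fc θs θc : ℝ → ℝ,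
      (∀ t, Φ t = Matrix.fromBlocks (selfCross (Ts t) (Tc t)) (selfCross (Fs t) (Fc t))
        (selfCross (Is t) (Ic t)) (selfCross (Ns t) (Nc t))) →
      (∀ t, Θ t = Matrix.fromRows (selfCross (θs t) (θc t)) (selfCross (Is t) (Ic t))) →
      (∀ z : ℂ, z.im ≤ 0 →
        impactDenominator (Ts - Tc) (Is - Ic) (Ns - Nc) (Fs - Fc) z ≠ 0) ∧
      (∃ ξ, HasLaplace ξ (xiTransform (Ts - Tc) (Is - Ic) (Ns - Nc) (Fs - Fc) (θs - θc))) ∧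
      ∀ ξ, HasLaplace ξ (xiTransform (Ts - Tc) (Is - Ic) (Ns - Nc) (Fs - Fc) (θs - θc)) →
        ∀ t, 0 ≤ t →
          Integrable (price P t) ℙ ∧
          ∫ ω, price P t ω ∂ℙ =
            conv (Is - Ic) (agentImbalance α) t -
              conv ξ (conv (Is - Ic) (agentImbalance α)) t) := by
  refine ⟨fun z hz => isUnit_det_one_sub_laplaceMatrix hΦ hstable hz,
    ⟨_, isResolvent_renewal hΦ hstable⟩, fun Ψ hΨ => ⟨hΨ.nonneg hΦ hstable, fun i t => ?_⟩,
    ae_mean_intensity_lt_top hΘ hΦ hstable hP hC hpast, ?_⟩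
  · simp_rw [lconvolution_congr_left (hΨ.ofReal_ae_eq hΦ hstable i _)]
    exact (mean_intensity_renewal hΘ hΦ hstable hP hC hpast i).1 t
  · intro Ts Tc Is Ic Ns Nc Fs Fc θs θc hblock hrow
    obtain rfl : Φ = blockKernel Ts Tc Is Ic Ns Nc Fs Fc := funext hblock
    obtain rfl : Θ = rowKernel θs θc Is Ic := funext hrow
    refine ⟨fun z hz => impactDenominator_ne_zero hΦ hstable hz,
      exists_hasLaplace_xiTransform hΦ hstable (hΘ (Sum.inl 0) 0) (hΘ (Sum.inl 0) 1),
      fun ξ hξ t _ => ?_⟩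
    have hpos : ∀ j, ∀ᵐ s ∂α j, 0 ≤ s := fun j => by
      filter_upwards [mem_ae_iff.2 (hα j)] with s hs
      exact hs.1
    obtain ⟨h1, h2⟩ := integral_price hΦ hΘ hstable hP hC hpast t
    exact ⟨h1, h2.trans (setIntegral_responseImbalance hΦ hΘ hstable hpos hξ t)⟩
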